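/- Theorem. A $t$-polytope in $\mathbb{R}^d$ is an intersection $P=\{x\in\mathbb{R}^d:\ h_P(x)\ge 0\}$ of $t\ge 1$ halfspaces, where $h_P(x)=\min_{1\le i\le t}(w_i\cdot x+b_i)$, $w_i\in\mathbb{R}^d$, $\|w_i\|_2=1$, $b_i\in\mathbb{R}$. Its $\gamma$-margin is $\{x:\ |h_P(x)|\le\gamma\}$. Given labelled points $(x_1,y_1),\dots,(x_n,y_n)$ with $\|x_i\|_2\le 1$ and $y_i\in\{-1,1\}$, we say that $P$, as a $\gamma$-fat $t$-polytope, is consistent with them if no $x_i$ lies in the $\gamma$-margin of $P$, and $x_i\in P$ if and only if $y_i=1$. For every $c\in\mathbb{N}$ there are a constant $C>0$ and two randomized real-RAM programs (exact real arithmetic $+,-,\times,/,\sqrt{\cdot}$ and comparisons, addition, subtraction and comparison of integers, indirect addressing, and draws of independent standard normal numbers, all at unit cost), depending only on $c$, with the following property. Let $n\ge 2$, $d\ge 1$, $t\ge 1$, $0<\gamma\le 1$, and let $n$ labelled points in the unit ball of $\mathbb{R}^d$ be given, such that some $\gamma$-fat $t$-polytope is consistent with them. On input $n,d,t,\gamma$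 and the labelled points: 1. the first program always halts within time $d\cdot n^{C\,t\,\gamma^{-2}\log(2/\gamma)}$, and with probability at least $1-n^{-c}$ it outputs (the unit normals and offsets of) a consistent $(\gamma/4)$-fat $t$-polytope; 2. the second program always halts within time $d\cdot n^{C\,\gamma^{-2}\log(2/\gamma)}$, and with probability at least $1-n^{-c}$ it outputs a consistent $(\gamma/4)$-fat $r$-polytope for some $r\le C\,t\log n$. -/

import Mathlib

open scoped ENNReal

/-! ## Polytopes and margins -/

/-- A `t`-polytope in `ℝ^d`, presented as an intersection of `t` halfspaces
`w i · x + b i ≥ 0` with unit normal vectors `w i`. -/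
structure TPolytope (d t : ℕ) where
  w : Fin t → EuclideanSpace ℝ (Fin d)
  b : Fin t → ℝ
  norm_w : ∀ i, ‖w i‖ = 1

namespace TPolytope

variable {d t : ℕ}

/-- `min_i (w i · x + b i)`.  The minimum is over a finite set, which is nonempty as soon as
`1 ≤ t`; for `t = 0` the value is `0`, so that every point lies in every margin and no nonempty
sample is consistent with a `0`-polytope. -/
noncomputable def height (P : TPolytope d t) (x : EuclideanSpace ℝ (Fin d)) : ℝ :=
  ⨅ i, (inner ℝ (P.w i) x + P.b i)

/-- The polytope as a set of points. -/
def carrier (P : TPolytope d t) : Set (EuclideanSpace ℝ (Fin d)) :=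
  {x | 0 ≤ P.height x}

def innerMargin (P : TPolytope d t) (γ : ℝ) : Set (EuclideanSpace ℝ (Fin d)) :=
  {x | 0 ≤ P.height x ∧ P.height x ≤ γ}

def outerMargin (P : TPolytope d t) (γ : ℝ) : Set (EuclideanSpace ℝ (Fin d)) :=
  {x | P.height x ≤ 0 ∧ -γ ≤ P.height x}

def margin (P : TPolytope d t) (γ : ℝ) : Set (EuclideanSpace ℝ (Fin d)) :=
  P.innerMargin γ ∪ P.outerMargin γ

/-- The labelled point `(x, y)` is classified correctly by the `γ`-fat polytope `P`: the point
is not in the `γ`-margin, and it is in `P` exactly when its label is positive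
(`true` is the label `1`, `false` is the label `-1`). -/
def Correct (P : TPolytope d t) (γ : ℝ) (x : EuclideanSpace ℝ (Fin d)) (y : Bool) : Prop :=
  x ∉ P.margin γ ∧ (x ∈ P.carrier ↔ y = true)

/-- `P`, as a `γ`-fat polytope, is consistent with the labelled points `(X i, y i)`. -/
def Consistent (P : TPolytope d t) (γ : ℝ) {n : ℕ}
    (X : Fin n → EuclideanSpace ℝ (Fin d)) (y : Fin n → Bool) : Prop :=
  ∀ i, P.Correct γ (X i) (y i)

end TPolytope

/-! ## A randomized real RAM

Programs are structured (`while`) programs over two kinds of memory, natural numbers and exact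
real numbers.  Each memory consists of tables with two indices, named by numbers that are fixed
in the program text; the cell `(0, 0)` of a table serves as a scalar variable.  Indices are
computed by the program (indirect addressing).  On naturals there are only `+` and truncated
`-`; on reals there are the field operations and the square root, with integer constants only and
no rounding to integers.  A program may also draw independent standard normal numbers. -/

namespace RealRAM

/-- The memory: `nat a i j` and `real a i j` are the cells `(i, j)` of the tables named `a`;
`drawn` is the number of random numbers drawn so far. -/
structure Store where
  nat : ℕ → ℕ → ℕ → ℕ
  real : ℕ → ℕ → ℕ → ℝ
  drawn : ℕ

inductive NatExpr where
  | const (m : ℕ)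
  | cell (a : ℕ) (i j : NatExpr)
  | add (e f : NatExpr)
  | sub (e f : NatExpr)

def NatExpr.eval (s : Store) : NatExpr → ℕ
  | .const m => m
  | .cell a i j => s.nat a (i.eval s) (j.eval s)
  | .add e f => e.eval s + f.eval s
  | .sub e f => e.eval s - f.eval s

/-- The number of operations in an expression, which is the time for evaluating it. -/
def NatExpr.size : NatExpr → ℕ
  | .const _ => 1
  | .cell _ i j => 1 + i.size + j.size
  | .add e f => 1 + e.size + f.size
  | .sub e f => 1 + e.size + f.size

inductive RealExpr where
  | const (m : ℕ)
  | cell (a : ℕ) (i j : NatExpr)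
  | ofNat (e : NatExpr)
  | add (e f : RealExpr)
  | sub (e f : RealExpr)
  | mul (e f : RealExpr)
  | div (e f : RealExpr)
  | sqrt (e : RealExpr)

/-- Division by zero and the square root of a negative number return `0`. -/
noncomputable def RealExpr.eval (s : Store) : RealExpr → ℝ
  | .const m => m
  | .cell a i j => s.real a (i.eval s) (j.eval s)
  | .ofNat e => (e.eval s : ℝ)
  | .add e f => e.eval s + f.eval s
  | .sub e f => e.eval s - f.eval s
  | .mul e f => e.eval s * f.eval s
  | .div e f => e.eval s / f.eval s
  | .sqrt e => Real.sqrt (e.eval s)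

def RealExpr.size : RealExpr → ℕ
  | .const _ => 1
  | .cell _ i j => 1 + i.size + j.size
  | .ofNat e => 1 + e.size
  | .add e f => 1 + e.size + f.size
  | .sub e f => 1 + e.size + f.size
  | .mul e f => 1 + e.size + f.size
  | .div e f => 1 + e.size + f.size
  | .sqrt e => 1 + e.size

inductive Test where
  | natLt (e f : NatExpr)
  | realLt (e f : RealExpr)
  | neg (p : Test)
  | both (p q : Test)

def Test.Holds (s : Store) : Test → Prop
  | .natLt e f => e.eval s < f.eval s
  | .realLt e f => e.eval s < f.eval s
  | .neg p => ¬ p.Holds s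
  | .both p q => p.Holds s ∧ q.Holds s

def Test.size : Test → ℕ
  | .natLt e f => 1 + e.size + f.size
  | .realLt e f => 1 + e.size + f.size
  | .neg p => 1 + p.size
  | .both p q => 1 + p.size + q.size

inductive Prog where
  | skip
  | setNat (a : ℕ) (i j : NatExpr) (e : NatExpr)
  | setReal (a : ℕ) (i j : NatExpr) (e : RealExpr)
  | draw (a : ℕ) (i j : NatExpr)
  | seq (p q : Prog)
  | cond (c : Test) (p q : Prog)
  | loop (c : Test) (p : Prog)

def Store.writeNat (s : Store) (a i j v : ℕ) : Store :=
  { s with nat := fun a' i' j' => if a' = a ∧ i' = i ∧ j' = j then v else s.nat a' i' j' }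

noncomputable def Store.writeReal (s : Store) (a i j : ℕ) (v : ℝ) : Store :=
  { s with real := fun a' i' j' => if a' = a ∧ i' = i ∧ j' = j then v else s.real a' i' j' }

/-- `Exec ω p s s' k`: started in the store `s`, with `ω` the sequence of random numbers, the
program `p` halts in the store `s'` after `k` time units.  Every assignment, draw and test takes
one time unit plus the sizes of the expressions it evaluates. -/
inductive Exec (ω : ℕ → ℝ) : Prog → Store → Store → ℕ → Prop where
  | skip (s : Store) : Exec ω .skip s s 1
  | setNat (a : ℕ) (i j e : NatExpr) (s : Store) :
      Exec ω (.setNat a i j e) s (s.writeNat a (i.eval s) (j.eval s) (e.eval s))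
        (1 + i.size + j.size + e.size)
  | setReal (a : ℕ) (i j : NatExpr) (e : RealExpr) (s : Store) :
      Exec ω (.setReal a i j e) s (s.writeReal a (i.eval s) (j.eval s) (e.eval s))
        (1 + i.size + j.size + e.size)
  | draw (a : ℕ) (i j : NatExpr) (s : Store) :
      Exec ω (.draw a i j) s
        { s.writeReal a (i.eval s) (j.eval s) (ω s.drawn) with drawn := s.drawn + 1 }
        (1 + i.size + j.size)
  | seq {p q : Prog} {s s' s'' : Store} {k l : ℕ} :
      Exec ω p s s' k → Exec ω q s' s'' l → Exec ω (.seq p q) s s'' (k + l)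
  | condTrue {c : Test} {p q : Prog} {s s' : Store} {k : ℕ} :
      c.Holds s → Exec ω p s s' k → Exec ω (.cond c p q) s s' (1 + c.size + k)
  | condFalse {c : Test} {p q : Prog} {s s' : Store} {k : ℕ} :
      ¬ c.Holds s → Exec ω q s s' k → Exec ω (.cond c p q) s s' (1 + c.size + k)
  | loopDone {c : Test} {p : Prog} {s : Store} :
      ¬ c.Holds s → Exec ω (.loop c p) s s (1 + c.size)
  | loopStep {c : Test} {p : Prog} {s s' s'' : Store} {k l : ℕ} :
      c.Holds s → Exec ω p s s' k → Exec ω (.loop c p) s' s'' l →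
        Exec ω (.loop c p) s s'' (1 + c.size + k + l)

/-- The law of a sequence of independent standard normal random numbers. -/
noncomputable def drawLaw : MeasureTheory.Measure (ℕ → ℝ) :=
  MeasureTheory.Measure.infinitePi fun _ => ProbabilityTheory.gaussianReal 0 1

/-- Started in the store `s₀`, the program always halts within time `T`, and with probability at
least `1 - ε` the final store satisfies `Good`. -/
def Computes (p : Prog) (s₀ : Store) (T : ℝ) (ε : ℝ≥0∞) (Good : Store → Prop) : Prop :=
  (∀ ω, ∃ s k, Exec ω p s₀ s k ∧ (k : ℝ) ≤ T) ∧
    drawLaw {ω | ¬ ∃ s k, Exec ω p s₀ s k ∧ Good s} ≤ ε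

/-- The initial store.  Tables of naturals: 0, 1, 2 hold `n`, `d`, `t` in their cells `(0, 0)`,
and 3 holds the label of point `i` in its cell `(i, 0)`, as `1` (positive) or `0` (negative).
Tables of reals: 0 holds `γ` in its cell `(0, 0)`, and 1 holds the `j`-th coordinate of point `i`
in its cell `(i, j)`.  All other cells are `0`. -/
def input {n d : ℕ} (t : ℕ) (γ : ℝ) (X : Fin n → EuclideanSpace ℝ (Fin d)) (y : Fin n → Bool) :
    Store where
  nat := fun a i j =>
    match a, i, j with
    | 0, 0, 0 => n
    | 1, 0, 0 => d
    | 2, 0, 0 => t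
    | 3, i, 0 => if h : i < n then (y ⟨i, h⟩).toNat else 0
    | _, _, _ => 0
  real := fun a i j =>
    match a, i, j with
    | 0, 0, 0 => γ
    | 1, i, j => if h : i < n ∧ j < d then X ⟨i, h.1⟩ ⟨j, h.2⟩ else 0
    | _, _, _ => 0
  drawn := 0

/-- The store holds the polytope `P` as output: table 4 of naturals holds the number `t` of
halfspaces in its cell `(0, 0)`; table 2 of reals holds the `j`-th coordinate of the `i`-th normal
vector in its cell `(i, j)`; and table 3 of reals holds the `i`-th offset in its cell `(i, 0)`. -/
def Outputs {d t : ℕ} (s : Store) (P : TPolytope d t) : Prop :=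
  s.nat 4 0 0 = t ∧ (∀ i : Fin t, ∀ j : Fin d, s.real 2 i j = P.w i j) ∧
    ∀ i : Fin t, s.real 3 i 0 = P.b i

end RealRAM

/-!
Both parts are proved with programs that draw no random numbers, so that the failure probability
is zero. They choose halfspaces from an explicit list of `n ^ O(γ⁻²)` candidates.

A halfspace `w · x + b ≥ 0` of the given polytope `P` separates the positive points from those
negative points at which `w · x + b < -γ`. By the analysis of the margin perceptron, a sum of
`K = ⌈3 / γ²⌉` differences of points, some of which may be zero, is the normal vector of a
hyperplane that still separates these two sets, with margin `γ / 4`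
(`exists_sum_sub_separating`); the offset can be read off from two of the points. So a halfspace
is encoded by a list of `2 K + 2` indices of points, that is, by a number below `n ^ (2 K + 2)`
whose digits in base `n` are these indices, and `t` such candidates together classify all points
correctly with margin `γ / 4` (`Inst.exists_candidate`, `inst_coverable`).

The first program, `exhaustiveSearch`, runs through the numbers below `n ^ ((2 K + 2) t)`, which
encode `t` candidates each. The second program, `greedyCover`, is the greedy algorithm for set
cover. It repeatedly searches for a candidate that contains all positive points and excludes at
least a fraction `1 / t` of the negative points not excluded so far. Such a candidate exists
(`Inst.Coverable.exists_useful`), so that after `r` rounds at most `n exp (-r / t)` negative points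
remain, and the algorithm stops after at most `t log n + 1` rounds (`GreedyInv`).

The time bounds come from a small program logic (`Run`) for total correctness. The programs use the
following memory, besides input and output. Tables of naturals: `5` holds `K`, `6` the number
of the candidate that is tried, `7` what remains of it when digits are removed, `8`, `9`, `13`,
`14` the counters for digits, coordinates, halfspaces and points, `11` and `12` indices of points,
`15` whether a check has failed, `17` whether a point is excluded, `18` the number of points that a
halfspace excludes, `19` the number of marked points, `20` the marks, and `10` a quotient. Tables
of reals: `4` and `6` hold values of sums, and `5` a norm or its square.
-/

/-! ### The margin perceptron -/

section Perceptron

variable {ι E : Type*} [NormedAddCommGroup E] [InnerProductSpace ℝ E]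

/-- If some hyperplane separates `P` from `Q` with margin `γ`, then so does, with margin `γ / 4`,
some hyperplane whose normal vector is a sum of `K` differences of points, where `K ≥ 3 / γ²`.
The perceptron that adds a difference as long as the margin condition fails makes fewer than
`3 / γ²` additions; the remaining differences may be chosen as zero. -/
theorem exists_sum_sub_separating {x : ι → E} (hx : ∀ i, ‖x i‖ ≤ 1) {P Q : ι → Prop} (i₀ : ι)
    {w₀ : E} (hw₀ : ‖w₀‖ = 1) {b γ : ℝ} (hγ : 0 < γ) (hP : ∀ i, P i → γ < inner ℝ w₀ (x i) + b)
    (hQ : ∀ i, Q i → inner ℝ w₀ (x i) + b < -γ) {K : ℕ} (hK : 3 / γ ^ 2 ≤ K) :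
    ∃ f g : ℕ → ι, ∀ p q, P p → Q q →
      γ / 2 * ‖∑ k ∈ Finset.range K, (x (f k) - x (g k))‖ <
        inner ℝ (∑ k ∈ Finset.range K, (x (f k) - x (g k))) (x p - x q) := by
  by_contra! hcon
  have key : ∀ k ≤ K, ∃ f g : ℕ → ι,
      ‖∑ l ∈ Finset.range k, (x (f l) - x (g l))‖ ^ 2 ≤ 12 * k ∧
      2 * γ * k ≤ inner ℝ w₀ (∑ l ∈ Finset.range k, (x (f l) - x (g l))) ∧
      (0 < k → 2 * γ * k < inner ℝ w₀ (∑ l ∈ Finset.range k, (x (f l) - x (g l)))) := by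
    intro k
    induction k with
    | zero => exact fun _ => ⟨fun _ => i₀, fun _ => i₀, by simp⟩
    | succ k ih =>
      intro hk
      obtain ⟨f, g, h1, h2, -⟩ := ih (by omega)
      set w := ∑ l ∈ Finset.range k, (x (f l) - x (g l)) with hw
      -- Pad the list with zero differences, so that the hypothesis applies.
      have hpad : ∑ l ∈ Finset.range K, (x (if l < k then f l else i₀) -
          x (if l < k then g l else i₀)) = w := by
        rw [hw, ← Finset.sum_subset (Finset.range_subset_range.2 (by omega : k ≤ K))]
        · refine Finset.sum_congr rfl fun l hl => ?_
          rw [if_pos (Finset.mem_range.1 hl), if_pos (Finset.mem_range.1 hl)]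
        · intro l _ hl
          rw [if_neg (mt Finset.mem_range.2 hl), if_neg (mt Finset.mem_range.2 hl), sub_self]
      obtain ⟨p, q, hp, hq, hpq⟩ := hcon (fun l => if l < k then f l else i₀)
        (fun l => if l < k then g l else i₀)
      rw [hpad] at hpq
      have hcs : inner ℝ w₀ w ≤ ‖w‖ := by
        simpa [hw₀] using real_inner_le_norm w₀ w
      have hw6 : γ * ‖w‖ ≤ 6 := by
        rcases (norm_nonneg w).eq_or_lt with h0 | h0
        · rw [← h0]; norm_num
        · have : ‖w‖ * (γ * ‖w‖) ≤ ‖w‖ * 6 := by nlinarith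
          exact le_of_mul_le_mul_left this h0
      have hz : ‖x p - x q‖ ^ 2 ≤ 4 := by
        have : ‖x p - x q‖ ≤ 2 := (norm_sub_le _ _).trans (by linarith [hx p, hx q])
        nlinarith [norm_nonneg (x p - x q)]
      have hw₀z : 2 * γ < inner ℝ w₀ (x p - x q) := by
        rw [inner_sub_right]
        linarith [hP p hp, hQ q hq]
      refine ⟨fun l => if l = k then p else f l, fun l => if l = k then q else g l, ?_⟩
      have hsum : ∑ l ∈ Finset.range (k + 1), (x (if l = k then p else f l) -
          x (if l = k then q else g l)) = w + (x p - x q) := by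
        rw [Finset.sum_range_succ, if_pos rfl, if_pos rfl, hw]
        congr 1
        refine Finset.sum_congr rfl fun l hl => ?_
        rw [if_neg (Finset.mem_range.1 hl).ne, if_neg (Finset.mem_range.1 hl).ne]
      rw [hsum, norm_add_sq_real, inner_add_right]
      push_cast
      refine ⟨by nlinarith, by linarith, fun _ => by linarith⟩
  obtain ⟨f, g, h1, -, h2⟩ := key K le_rfl
  set w := ∑ l ∈ Finset.range K, (x (f l) - x (g l))
  have hK0 : (0 : ℝ) < K := lt_of_lt_of_le (by positivity) hK
  have h2 := h2 (by exact_mod_cast hK0)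
  have hcs : inner ℝ w₀ w ≤ ‖w‖ := by
    simpa [hw₀] using real_inner_le_norm w₀ w
  rw [div_le_iff₀ (by positivity)] at hK
  have h3 : (2 * γ * K) ^ 2 < ‖w‖ ^ 2 := by
    have := h2.trans_le hcs
    gcongr
  nlinarith

end Perceptron

/-! ### Polytopes and their halfspaces -/

namespace TPolytope

variable {d t : ℕ} (P : TPolytope d t) {γ : ℝ} {x : EuclideanSpace ℝ (Fin d)}

theorem height_le (i : Fin t) : P.height x ≤ inner ℝ (P.w i) x + P.b i :=
  ciInf_le (Set.finite_range _).bddBelow i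

theorem exists_eq_height (ht : 0 < t) : ∃ i, inner ℝ (P.w i) x + P.b i = P.height x :=
  haveI : Nonempty (Fin t) := ⟨⟨0, ht⟩⟩
  exists_eq_ciInf_of_finite

theorem correct_iff (hγ : 0 < γ) (ht : 0 < t) (y : Bool) :
    P.Correct γ x y ↔ if y = true then ∀ i, γ < inner ℝ (P.w i) x + P.b i
      else ∃ i, inner ℝ (P.w i) x + P.b i < -γ := by
  have h : P.Correct γ x y ↔ if y = true then γ < P.height x else P.height x < -γ := by
    simp only [Correct, margin, innerMargin, outerMargin, carrier, Set.mem_union,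
      Set.mem_ofPred_eq, not_or, not_and, not_le]
    cases y
    · simp only [Bool.false_eq_true, iff_false, not_le, if_false]
      exact ⟨fun h => h.1.2 h.2.le, fun h =>
        ⟨⟨fun h' => by linarith, fun _ => h⟩, by linarith⟩⟩
    · simp only [iff_true, if_true]
      exact ⟨fun h => h.1.1 h.2, fun h => ⟨⟨fun _ => h, fun h' => by linarith⟩, by linarith⟩⟩
  obtain ⟨i₀, hi₀⟩ := P.exists_eq_height (x := x) ht
  rw [h]
  split_ifs
  · exact ⟨fun h i => h.trans_le (P.height_le i), fun h => hi₀ ▸ h i₀⟩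
  · exact ⟨fun h => ⟨i₀, hi₀ ▸ h⟩, fun ⟨i, hi⟩ => (P.height_le i).trans_lt hi⟩

/-- No nonempty sample is consistent with a polytope without halfspaces. -/
theorem Consistent.pos {P : TPolytope d t} (hγ : 0 < γ) {n : ℕ} (hn : 0 < n)
    {X : Fin n → EuclideanSpace ℝ (Fin d)} {y : Fin n → Bool} (h : P.Consistent γ X y) :
    0 < t := by
  rcases Nat.eq_zero_or_pos t with rfl | ht
  · refine absurd ?_ (h ⟨0, hn⟩).1
    simp [margin, innerMargin, height, hγ.le]
  · exact ht

theorem dim_pos (P : TPolytope d t) (ht : 0 < t) : 0 < d := by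
  rcases Nat.eq_zero_or_pos d with rfl | hd
  · have := P.norm_w ⟨0, ht⟩
    rw [Subsingleton.elim (P.w ⟨0, ht⟩) 0, norm_zero] at this
    exact absurd this zero_ne_one
  · exact hd

end TPolytope

namespace RealRAM

/-! ### Reasoning about programs -/

/-- The tables of naturals that a program may write to. -/
def Prog.natTables : Prog → List ℕ
  | .setNat a _ _ _ => [a]
  | .seq p q => p.natTables ++ q.natTables
  | .cond _ p q => p.natTables ++ q.natTables
  | .loop _ p => p.natTables
  | _ => []

/-- The tables of reals that a program may write to. -/
def Prog.realTables : Prog → List ℕ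
  | .setReal a _ _ _ => [a]
  | .draw a _ _ => [a]
  | .seq p q => p.realTables ++ q.realTables
  | .cond _ p q => p.realTables ++ q.realTables
  | .loop _ p => p.realTables
  | _ => []

/-- The stores `s` and `s'` agree on all tables that `p` does not write to. -/
structure Frame (p : Prog) (s s' : Store) : Prop where
  nat : ∀ a, a ∉ p.natTables → s'.nat a = s.nat a
  real : ∀ a, a ∉ p.realTables → s'.real a = s.real a

section Write

variable (s : Store) (a i j v : ℕ) (z : ℝ)

@[simp] theorem Store.writeNat_nat_self (i' j' : ℕ) :
    (s.writeNat a i j v).nat a i' j' = if i' = i ∧ j' = j then v else s.nat a i' j' := by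
  simp [Store.writeNat]

@[simp] theorem Store.writeNat_nat_of_ne {a' : ℕ} (h : a' ≠ a) :
    (s.writeNat a i j v).nat a' = s.nat a' := by
  funext i' j'
  simp [Store.writeNat, h]

@[simp] theorem Store.writeNat_real : (s.writeNat a i j v).real = s.real := rfl

@[simp] theorem Store.writeReal_real_self (i' j' : ℕ) :
    (s.writeReal a i j z).real a i' j' = if i' = i ∧ j' = j then z else s.real a i' j' := by
  simp [Store.writeReal]

@[simp] theorem Store.writeReal_real_of_ne {a' : ℕ} (h : a' ≠ a) :
    (s.writeReal a i j z).real a' = s.real a' := by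
  funext i' j'
  simp [Store.writeReal, h]

@[simp] theorem Store.writeReal_nat : (s.writeReal a i j z).nat = s.nat := rfl

end Write

theorem Exec.frame {ω : ℕ → ℝ} {p : Prog} {s s' : Store} {k : ℕ} (h : Exec ω p s s' k) :
    Frame p s s' := by
  induction h with
  | skip s => exact ⟨fun _ _ => rfl, fun _ _ => rfl⟩
  | setNat a i j e s =>
    exact ⟨fun b hb => by
      rw [Store.writeNat_nat_of_ne]; simpa [Prog.natTables] using hb, fun _ _ => rfl⟩
  | setReal a i j e s =>
    exact ⟨fun _ _ => rfl, fun b hb => by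
      rw [Store.writeReal_real_of_ne]; simpa [Prog.realTables] using hb⟩
  | draw a i j s =>
    exact ⟨fun _ _ => rfl, fun b hb =>
      Store.writeReal_real_of_ne _ _ _ _ _ (by simpa [Prog.realTables] using hb)⟩
  | seq _ _ ih₁ ih₂ =>
    refine ⟨fun b hb => ?_, fun b hb => ?_⟩ <;>
      simp only [Prog.natTables, Prog.realTables, List.mem_append, not_or] at hb
    · rw [ih₂.nat b hb.2, ih₁.nat b hb.1]
    · rw [ih₂.real b hb.2, ih₁.real b hb.1]
  | condTrue _ _ ih =>
    refine ⟨fun b hb => ?_, fun b hb => ?_⟩ <;>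
      simp only [Prog.natTables, Prog.realTables, List.mem_append, not_or] at hb
    · exact ih.nat b hb.1
    · exact ih.real b hb.1
  | condFalse _ _ ih =>
    refine ⟨fun b hb => ?_, fun b hb => ?_⟩ <;>
      simp only [Prog.natTables, Prog.realTables, List.mem_append, not_or] at hb
    · exact ih.nat b hb.2
    · exact ih.real b hb.2
  | loopDone _ => exact ⟨fun _ _ => rfl, fun _ _ => rfl⟩
  | loopStep _ _ _ ih₁ ih₂ =>
    refine ⟨fun b hb => ?_, fun b hb => ?_⟩
    · rw [ih₂.nat b hb, ih₁.nat b hb]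
    · rw [ih₂.real b hb, ih₁.real b hb]

theorem Frame.trans {p : Prog} {s s' s'' : Store} (h : Frame p s s') (h' : Frame p s' s'') :
    Frame p s s'' :=
  ⟨fun a ha => (h'.nat a ha).trans (h.nat a ha), fun a ha => (h'.real a ha).trans (h.real a ha)⟩

/-- Total correctness with a time bound, whatever random numbers are drawn: started in `s`, the
program `p` halts within time `T` in a store that satisfies `Q`. -/
def Run (p : Prog) (s : Store) (T : ℕ) (Q : Store → Prop) : Prop :=
  ∀ ω, ∃ s' k, Exec ω p s s' k ∧ k ≤ T ∧ Q s'

theorem Run.mono {p : Prog} {s : Store} {T T' : ℕ} {Q Q' : Store → Prop} (h : Run p s T Q)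
    (hT : T ≤ T') (hQ : ∀ s', Frame p s s' → Q s' → Q' s') : Run p s T' Q' := by
  intro ω
  obtain ⟨s', k, he, hk, hq⟩ := h ω
  exact ⟨s', k, he, hk.trans hT, hQ s' he.frame hq⟩

theorem Run.time {p : Prog} {s : Store} {T T' : ℕ} {Q : Store → Prop} (h : Run p s T Q)
    (hT : T ≤ T') : Run p s T' Q :=
  h.mono hT fun _ _ h => h

theorem Run.seq {p q : Prog} {s : Store} {T₁ T₂ : ℕ} {R Q : Store → Prop} (hp : Run p s T₁ R)
    (hq : ∀ s', Frame p s s' → R s' → Run q s' T₂ Q) : Run (.seq p q) s (T₁ + T₂) Q := by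
  intro ω
  obtain ⟨s', k, he, hk, hr⟩ := hp ω
  obtain ⟨s'', l, he', hl, hQ⟩ := hq s' he.frame hr ω
  exact ⟨s'', k + l, he.seq he', by omega, hQ⟩

theorem Run.cond {c : Test} {p q : Prog} {s : Store} {T : ℕ} {Q : Store → Prop}
    (hp : c.Holds s → Run p s T Q) (hq : ¬ c.Holds s → Run q s T Q) :
    Run (.cond c p q) s (1 + c.size + T) Q := by
  intro ω
  by_cases h : c.Holds s
  · obtain ⟨s', k, he, hk, hQ⟩ := hp h ω
    exact ⟨s', _, .condTrue h he, by omega, hQ⟩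
  · obtain ⟨s', k, he, hk, hQ⟩ := hq h ω
    exact ⟨s', _, .condFalse h he, by omega, hQ⟩

/-- The rule for loops, with an invariant `I` and a decreasing measure `f`. -/
theorem Run.loop {c : Test} {p : Prog} {T : ℕ} (I : Store → Prop) (f : Store → ℕ)
    (hstep : ∀ s, I s → c.Holds s → Run p s T fun s' => I s' ∧ f s' < f s) {s : Store}
    (hI : I s) {B k : ℕ} (hB : f s ≤ B) (hk : 1 + c.size = k) :
    Run (.loop c p) s (B * (T + k) + k) fun s' => I s' ∧ ¬ c.Holds s' := by
  suffices h : Run (.loop c p) s (f s * (T + (1 + c.size)) + (1 + c.size))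
      fun s' => I s' ∧ ¬ c.Holds s' from
    h.time (hk ▸ Nat.add_le_add_right (Nat.mul_le_mul_right _ hB) _)
  clear hB
  intro ω
  induction hm : f s using Nat.strong_induction_on generalizing s with
  | _ m ih =>
    subst hm
    by_cases hc : c.Holds s
    · obtain ⟨s', k, he, hk, hI', hlt⟩ := hstep s hI hc ω
      obtain ⟨s'', l, he', hl, hQ⟩ := ih (f s') hlt hI' rfl
      refine ⟨s'', _, .loopStep hc he he', ?_, hQ⟩
      have : (f s' + 1) * (T + (1 + c.size)) ≤ f s * (T + (1 + c.size)) :=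
        Nat.mul_le_mul_right _ hlt
      rw [Nat.add_mul] at this
      omega
    · exact ⟨s, _, .loopDone hc, by omega, hI, hc⟩

/-- Programs without loops and draws. -/
def Prog.straight : Prog → Bool
  | .skip => true
  | .setNat _ _ _ _ => true
  | .setReal _ _ _ _ => true
  | .draw _ _ _ => false
  | .seq p q => p.straight && q.straight
  | .cond _ p q => p.straight && q.straight
  | .loop _ _ => false

/-- An upper bound for the time that a straight program takes. -/
def Prog.cost : Prog → ℕ
  | .skip => 1
  | .setNat _ i j e => 1 + i.size + j.size + e.size
  | .setReal _ i j e => 1 + i.size + j.size + e.size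
  | .draw _ _ _ => 0
  | .seq p q => p.cost + q.cost
  | .cond c p q => 1 + c.size + (p.cost + q.cost)
  | .loop _ _ => 0

open Classical in
/-- The effect of a straight program on the store. -/
noncomputable def Prog.effect : Prog → Store → Store
  | .skip, s => s
  | .setNat a i j e, s => s.writeNat a (i.eval s) (j.eval s) (e.eval s)
  | .setReal a i j e, s => s.writeReal a (i.eval s) (j.eval s) (e.eval s)
  | .draw _ _ _, s => s
  | .seq p q, s => q.effect (p.effect s)
  | .cond c p q, s => if c.Holds s then p.effect s else q.effect s
  | .loop _ _, s => s

theorem Run.straight {p : Prog} (hp : p.straight = true) {s : Store} {Q : Store → Prop}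
    (hQ : Q (p.effect s)) : Run p s p.cost Q := by
  suffices h : Run p s p.cost (· = p.effect s) from h.mono le_rfl fun s' _ h => h ▸ hQ
  clear hQ
  induction p generalizing s with
  | skip => exact fun ω => ⟨_, _, .skip s, le_rfl, rfl⟩
  | setNat a i j e => exact fun ω => ⟨_, _, .setNat a i j e s, le_rfl, rfl⟩
  | setReal a i j e => exact fun ω => ⟨_, _, .setReal a i j e s, le_rfl, rfl⟩
  | draw => simp [Prog.straight] at hp
  | seq p q ihp ihq =>
    simp only [Prog.straight, Bool.and_eq_true] at hp
    exact (ihp hp.1).seq fun s' _ h => h ▸ ihq hp.2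
  | cond c p q ihp ihq =>
    simp only [Prog.straight, Bool.and_eq_true] at hp
    refine Run.cond (fun h => ?_) (fun h => ?_)
    · exact (ihp hp.1).mono (by omega) fun s' _ hs => by simpa [Prog.effect, h] using hs
    · exact (ihq hp.2).mono (by omega) fun s' _ hs => by simpa [Prog.effect, h] using hs
  | loop => simp [Prog.straight] at hp

theorem Run.straight_seq {p q : Prog} (hp : p.straight = true) {s : Store} {T : ℕ}
    {Q : Store → Prop} (hq : Run q (p.effect s) T Q) : Run (.seq p q) s (p.cost + T) Q :=
  (Run.straight hp (Q := (· = p.effect s)) rfl).seq fun _ _ h => h ▸ hq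

theorem Frame.effect {p : Prog} (hp : p.straight = true) (s : Store) : Frame p s (p.effect s) := by
  obtain ⟨s', k, he, -, rfl⟩ := Run.straight hp (s := s) (Q := (· = p.effect s)) rfl (fun _ => 0)
  exact he.frame

/-- The scalar variable of type `ℕ` kept in table `a`. -/
def nv (a : ℕ) : NatExpr := .cell a (.const 0) (.const 0)

/-- The scalar variable of type `ℝ` kept in table `a`. -/
def rv (a : ℕ) : RealExpr := .cell a (.const 0) (.const 0)

/-- Assignment to the scalar variable of type `ℕ` kept in table `a`. -/
def setN (a : ℕ) (e : NatExpr) : Prog := .setNat a (.const 0) (.const 0) e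

/-- Assignment to the scalar variable of type `ℝ` kept in table `a`. -/
def setR (a : ℕ) (e : RealExpr) : Prog := .setReal a (.const 0) (.const 0) e

@[simp] theorem nv_eval (a : ℕ) (s : Store) : (nv a).eval s = s.nat a 0 0 := rfl

@[simp] theorem rv_eval (a : ℕ) (s : Store) : (rv a).eval s = s.real a 0 0 := rfl

@[simp] theorem setN_effect (a : ℕ) (e : NatExpr) (s : Store) :
    (setN a e).effect s = s.writeNat a 0 0 (e.eval s) := rfl

@[simp] theorem setR_effect (a : ℕ) (e : RealExpr) (s : Store) :
    (setR a e).effect s = s.writeReal a 0 0 (e.eval s) := rfl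

/-- `for v := 0, …, B - 1 do p`, where `B` is the value of the variable `b`. -/
def forTo (v b : ℕ) (p : Prog) : Prog :=
  .seq (setN v (.const 0)) (.loop (.natLt (nv v) (nv b)) (.seq p (setN v (.add (nv v) (.const 1)))))

/-- The rule for counting loops: `I i` holds before the body is run for the `i`-th time. -/
theorem Run.forTo {v b : ℕ} {p : Prog} {T B : ℕ} {s : Store} (I : ℕ → Store → Prop)
    (hB : s.nat b 0 0 = B) (hvb : v ≠ b) (hv : v ∉ p.natTables) (hb : b ∉ p.natTables)
    (hI : ∀ i s' x, I i s' → I i (s'.writeNat v 0 0 x)) (h0 : I 0 s)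
    (hstep : ∀ i s', i < B → Frame (forTo v b p) s s' → s'.nat v 0 0 = i → I i s' →
      Run p s' T (I (i + 1))) :
    Run (forTo v b p) s (B * (T + 16) + 12) (I B) := by
  have key := Run.loop (c := .natLt (nv v) (nv b)) (T := T + 8)
    (p := .seq p (setN v (.add (nv v) (.const 1))))
    (fun s' => Frame (RealRAM.forTo v b p) s s' ∧ s'.nat v 0 0 ≤ B ∧ I (s'.nat v 0 0) s')
    (fun s' => B - s'.nat v 0 0) (s := s.writeNat v 0 0 0) ?_ ?_ (B := B)
    (Nat.sub_le _ _) (k := 8) rfl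
  · refine (Run.straight_seq (p := setN v (.const 0)) rfl key).mono ?_ ?_
    · have : (setN v (.const 0)).cost = 4 := rfl
      rw [this, add_assoc T 8 8]
      omega
    · rintro s' - ⟨⟨hf, hle, hIB⟩, hlt⟩
      simp only [Test.Holds, nv_eval, not_lt] at hlt
      rw [hf.nat b (by
        simp [RealRAM.forTo, Prog.natTables, setN, hb, hvb.symm]), hB] at hlt
      rwa [le_antisymm hle hlt] at hIB
  · rintro s' ⟨hf, hle, hIi⟩ hlt
    have hbB : s'.nat b 0 0 = B := by
      rw [hf.nat b (by simp [RealRAM.forTo, Prog.natTables, setN, hb, hvb.symm]), hB]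
    simp only [Test.Holds, nv_eval, hbB] at hlt
    refine ((hstep _ s' hlt hf rfl hIi).seq fun s'' hf'' hI'' => Run.straight rfl
      (Q := fun t => (Frame (RealRAM.forTo v b p) s t ∧ t.nat v 0 0 ≤ B ∧ I (t.nat v 0 0) t) ∧
        B - t.nat v 0 0 < B - s'.nat v 0 0) ?_).mono ?_ (fun _ _ h => h)
    · have hv'' : s''.nat v 0 0 = s'.nat v 0 0 := by rw [hf''.nat v hv]
      simp only [setN_effect, NatExpr.eval, nv_eval, hv'', Store.writeNat_nat_self, and_self,
        if_true]
      refine ⟨⟨?_, hlt, hI _ _ _ hI''⟩, by omega⟩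
      refine hf.trans ⟨fun a ha => ?_, fun a ha => ?_⟩
      · simp [RealRAM.forTo, Prog.natTables, setN] at ha
        rw [Store.writeNat_nat_of_ne _ _ _ _ _ ha.1, hf''.nat a ha.2.1]
      · simp [RealRAM.forTo, Prog.realTables, setN] at ha
        rw [Store.writeNat_real, hf''.real a ha]
    · simp [Prog.cost, setN, NatExpr.size, nv]
  · refine ⟨⟨fun a ha => ?_, fun a ha => rfl⟩, by simp, by simpa using hI 0 s 0 h0⟩
    simp [RealRAM.forTo, Prog.natTables, setN] at ha
    rw [Store.writeNat_nat_of_ne _ _ _ _ _ ha.1]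

/-- A program that reaches a good store whatever is drawn computes with failure probability
zero. -/
theorem Run.computes {p : Prog} {s : Store} {T : ℕ} {Q : Store → Prop} (h : Run p s T Q) {T' : ℝ}
    (hT : (T : ℝ) ≤ T') (ε : ℝ≥0∞) : Computes p s T' ε Q := by
  refine ⟨fun ω => ?_, ?_⟩
  · obtain ⟨s', k, he, hk, -⟩ := h ω
    exact ⟨s', k, he, (Nat.cast_le.2 hk).trans hT⟩
  · have : {ω | ¬ ∃ s' k, Exec ω p s s' k ∧ Q s'} = ∅ := by
      refine Set.eq_empty_iff_forall_notMem.2 fun ω hω => hω ?_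
      obtain ⟨s', k, he, -, hq⟩ := h ω
      exact ⟨s', k, he, hq⟩
    rw [this]
    simp

local infixr:70 " ⨟ " => Prog.seq

/-! ### Building a candidate halfspace -/

/-- An instance of the problem as a program sees it, with the number `K` of differences that are
added up in a candidate normal vector. -/
structure Inst where
  n : ℕ
  d : ℕ
  t : ℕ
  K : ℕ
  γ : ℝ
  x : ℕ → ℕ → ℝ
  y : ℕ → ℕ
  n_pos : 0 < n
  d_pos : 0 < d

/-- The store `s` holds the instance `D`. -/
structure Loaded (D : Inst) (s : Store) : Prop where
  n : s.nat 0 0 0 = D.n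
  d : s.nat 1 0 0 = D.d
  t : s.nat 2 0 0 = D.t
  y : ∀ i, s.nat 3 i 0 = D.y i
  K : s.nat 5 0 0 = D.K
  γ : s.real 0 0 0 = D.γ
  x : s.real 1 = D.x

theorem Loaded.frame {D : Inst} {p : Prog} {s s' : Store} (h : Loaded D s) (hf : Frame p s s')
    (hn : ∀ a ∈ [0, 1, 2, 3, 5], a ∉ p.natTables) (hr : ∀ a ∈ [0, 1], a ∉ p.realTables) :
    Loaded D s' where
  n := by rw [hf.nat 0 (hn 0 (by decide)), h.n]
  d := by rw [hf.nat 1 (hn 1 (by decide)), h.d]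
  t := by rw [hf.nat 2 (hn 2 (by decide)), h.t]
  y i := by rw [hf.nat 3 (hn 3 (by decide)), h.y]
  K := by rw [hf.nat 5 (hn 5 (by decide)), h.K]
  γ := by rw [hf.real 0 (hr 0 (by decide)), h.γ]
  x := by rw [hf.real 1 (hr 1 (by decide)), h.x]

/-- The `k`-th digit of `m` in base `n`. -/
def digit (n m k : ℕ) : ℕ := m / n ^ k % n

namespace Inst

variable (D : Inst) (f : ℕ → ℕ)

/-- The sum of the first `k` differences of points, where `f` lists the indices of the points. -/
noncomputable def diffSum (k q : ℕ) : ℝ :=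
  ∑ l ∈ Finset.range k, (D.x (f (2 * l)) q - D.x (f (2 * l + 1)) q)

/-- The squared norm of the sum of all `K` differences. -/
noncomputable def sqNorm : ℝ := ∑ q ∈ Finset.range D.d, D.diffSum f D.K q ^ 2

/-- The normal vector of the candidate halfspace with index list `f`: the sum of `K` differences,
normalised, or the first unit vector if that sum vanishes. -/
noncomputable def candNormal (q : ℕ) : ℝ :=
  if 0 < D.sqNorm f then D.diffSum f D.K q / √(D.sqNorm f) else if q = 0 then 1 else 0

/-- The offset of the candidate halfspace with index list `f`: its boundary passes through the
midpoint of the last two points in the list; if the sum of differences vanishes, the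
halfspace contains the whole unit ball or none of it, according to a label. -/
noncomputable def candOffset : ℝ :=
  if 0 < D.sqNorm f then
    ∑ q ∈ Finset.range D.d,
      -(D.candNormal f q * (D.x (f (2 * D.K)) q + D.x (f (2 * D.K + 1)) q) / 2)
  else 4 * D.y (f (2 * D.K)) - 2

/-- The value at point `i` of the affine function that defines the candidate halfspace. -/
noncomputable def candValue (i : ℕ) : ℝ :=
  D.candOffset f + ∑ q ∈ Finset.range D.d, D.candNormal f q * D.x i q

/-- The number of digits in base `n` that encode one candidate halfspace. -/
def len : ℕ := 2 * D.K + 2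

end Inst

/-- Store in `dst` the last digit in base `n` of variable `7`, and remove that digit. -/
def popDigit (dst : ℕ) : Prog :=
  setN 10 (.const 0) ⨟
  .loop (.neg (.natLt (nv 7) (nv 0)))
    (setN 7 (.sub (nv 7) (nv 0)) ⨟ setN 10 (.add (nv 10) (.const 1))) ⨟
  setN dst (nv 7) ⨟ setN 7 (nv 10)

theorem popDigit_run {D : Inst} {s : Store} (hs : Loaded D s) {dst m M : ℕ} (hm : s.nat 7 0 0 = m)
    (hM : m ≤ M) (h7 : dst ≠ 7) (h10 : dst ≠ 10) :
    Run (popDigit dst) s (27 * M + 25)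
      fun s' => s'.nat dst 0 0 = m % D.n ∧ s'.nat 7 0 0 = m / D.n := by
  have hn := D.n_pos
  have key := Run.loop (c := .neg (.natLt (nv 7) (nv 0))) (T := 18)
    (p := setN 7 (.sub (nv 7) (nv 0)) ⨟ setN 10 (.add (nv 10) (.const 1)))
    (fun s' => s'.nat 0 0 0 = D.n ∧ s'.nat 7 0 0 % D.n = m % D.n ∧
      s'.nat 7 0 0 / D.n + s'.nat 10 0 0 = m / D.n)
    (fun s' => s'.nat 7 0 0) (s := s.writeNat 10 0 0 0) ?_ ?_
    (B := M) (by simpa [hm] using hM) (k := 9) rfl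
  · refine (Run.straight_seq rfl (key.seq fun s' hf hs' => Run.straight rfl
      (Q := fun s' => s'.nat dst 0 0 = m % D.n ∧ s'.nat 7 0 0 = m / D.n) ?_)).time ?_
    · obtain ⟨⟨h0, h1, h2⟩, h3⟩ := hs'
      simp only [Test.Holds, nv_eval, h0, not_not] at h3
      rw [Nat.mod_eq_of_lt h3] at h1
      rw [Nat.div_eq_of_lt h3, zero_add] at h2
      simp [Prog.effect, h7, h10.symm, h1, h2]
    · simp [Prog.cost, setN, NatExpr.size, nv]
      omega
  · rintro s' ⟨h0, h1, h2⟩ hlt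
    simp only [Test.Holds, nv_eval, h0, not_lt] at hlt
    refine (Run.straight rfl ?_).time (by decide)
    simp [Prog.effect, NatExpr.eval, h0]
    refine ⟨⟨?_, ?_⟩, by omega, hn⟩
    · rw [← h1, ← Nat.mod_eq_sub_mod hlt]
    · rw [← h2, Nat.div_eq_sub_div hn hlt]
      omega
  · simp [hs.n, hm]

/-- The current coordinate of the current normal vector. -/
def wCell : RealExpr := .cell 2 (nv 13) (nv 9)

/-- The current coordinate of the point whose index is in variable `a`. -/
def xCell (a : ℕ) : RealExpr := .cell 1 (nv a) (nv 9)

/-- Set row `13` of the table of normal vectors to zero. -/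
def clearRow : Prog := forTo 9 1 (.setReal 2 (nv 13) (nv 9) (.const 0))

theorem clearRow_run {D : Inst} {s : Store} (hs : Loaded D s) {J : ℕ} (hJ : s.nat 13 0 0 = J) :
    Run clearRow s (D.d * (8 + 16) + 12) fun s' => (∀ q < D.d, s'.real 2 J q = 0) ∧
      ∀ j ≠ J, s'.real 2 j = s.real 2 j := by
  refine Run.forTo (fun i s' => (∀ q < i, s'.real 2 J q = 0) ∧
      ∀ j ≠ J, s'.real 2 j = s.real 2 j) hs.d (by decide) (by decide) (by decide) ?_ ?_ ?_
  · intro i s' x h; simpa using h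
  · simp
  · rintro i s' - hf hi ⟨h1, h2⟩
    have e13 := hf.nat 13 (by decide)
    refine (Run.straight rfl ⟨fun q hq => ?_, fun j hj => ?_⟩).time (by decide)
    · simp [Prog.effect, RealExpr.eval, hi, e13, hJ]
      intro h; exact h1 q (by omega)
    · funext q
      simp [Prog.effect, e13, hJ, hj, h2 j hj]

/-- Add to row `13` the difference of the points whose indices are in variables `11` and `12`. -/
def addDiff : Prog :=
  forTo 9 1 (.setReal 2 (nv 13) (nv 9) (.add wCell (.sub (xCell 11) (xCell 12))))

theorem addDiff_run {D : Inst} {s : Store} (hs : Loaded D s) {J a b : ℕ}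
    (hJ : s.nat 13 0 0 = J) (ha : s.nat 11 0 0 = a) (hb : s.nat 12 0 0 = b) :
    Run addDiff s (D.d * (30 + 16) + 12) fun s' =>
      (∀ q < D.d, s'.real 2 J q = s.real 2 J q + (D.x a q - D.x b q)) ∧
      ∀ j ≠ J, s'.real 2 j = s.real 2 j := by
  refine (Run.forTo (T := 30) (fun i s' => (∀ q, s'.real 2 J q =
        if q < i then s.real 2 J q + (D.x a q - D.x b q) else s.real 2 J q) ∧
      ∀ j ≠ J, s'.real 2 j = s.real 2 j) hs.d (by decide) (by decide) (by decide) ?_ ?_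
        ?_).mono le_rfl ?_
  · intro i s' x h; simpa using h
  · simp
  · rintro i s' - hf hi ⟨h1, h2⟩
    have hs' := hs.frame hf (by decide) (by decide)
    have e13 := hf.nat 13 (by decide)
    have e11 := hf.nat 11 (by decide)
    have e12 := hf.nat 12 (by decide)
    refine (Run.straight rfl ⟨fun q => ?_, fun j hj => ?_⟩).time (by decide)
    · simp only [Prog.effect, RealExpr.eval, nv_eval, hi, e13, hJ, wCell, xCell, e11, e12, ha, hb,
        hs'.x, Store.writeReal_real_self, h1]
      rcases lt_trichotomy q i with h | rfl | h
      · simp [h, h.ne, Nat.lt_succ_of_lt h]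
      · simp
      · simp [h.ne', h.not_gt, show ¬ q < i + 1 by omega]
    · funext q
      simp [Prog.effect, e13, hJ, hj, h2 j hj]
  · rintro s' - ⟨h1, h2⟩
    exact ⟨fun q hq => by rw [h1, if_pos hq], h2⟩

/-- Add `K` differences of points to row `13`; their indices are the last digits of
variable `7`. -/
def sumDiffs : Prog := forTo 8 5 (popDigit 11 ⨟ popDigit 12 ⨟ addDiff)

theorem sumDiffs_run {D : Inst} {s : Store} (hs : Loaded D s) {J m : ℕ}
    (hJ : s.nat 13 0 0 = J) (hm : s.nat 7 0 0 = m) (h0 : ∀ q < D.d, s.real 2 J q = 0) :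
    Run sumDiffs s (D.K * (54 * m + 46 * D.d + 62 + 16) + 12) fun s' =>
      (s'.nat 7 0 0 = m / D.n ^ (2 * D.K) ∧
        ∀ q < D.d, s'.real 2 J q = D.diffSum (digit D.n m) D.K q) ∧
      ∀ j ≠ J, s'.real 2 j = s.real 2 j := by
  refine Run.forTo (fun k s' => (s'.nat 7 0 0 = m / D.n ^ (2 * k) ∧
        ∀ q < D.d, s'.real 2 J q = D.diffSum (digit D.n m) k q) ∧
      ∀ j ≠ J, s'.real 2 j = s.real 2 j) hs.K (by decide) (by decide) (by decide) ?_ ?_ ?_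
  · intro i s' x h; simpa using h
  · simpa [hm, Inst.diffSum] using h0
  · rintro k s' - hf hk ⟨⟨h1, h2⟩, h3⟩
    have hs' := hs.frame hf (by decide) (by decide)
    have hm' : m / D.n ^ (2 * k) ≤ m := Nat.div_le_self _ _
    have hm'' : m / D.n ^ (2 * k) / D.n ≤ m := (Nat.div_le_self _ _).trans hm'
    refine ((popDigit_run (dst := 11) hs' h1 hm' (by decide) (by decide)).seq
      fun s₁ hf₁ ⟨ha, h7⟩ => ?_).time
      (T := (27 * m + 25) + ((27 * m + 25) + (D.d * (30 + 16) + 12))) (by omega)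
    have hs₁ := hs'.frame hf₁ (by decide) (by decide)
    refine (popDigit_run (dst := 12) hs₁ h7 hm'' (by decide) (by decide)).seq
      fun s₂ hf₂ ⟨hb, h7'⟩ => ?_
    have hs₂ := hs₁.frame hf₂ (by decide) (by decide)
    refine (addDiff_run (J := J) (a := digit D.n m (2 * k)) (b := digit D.n m (2 * k + 1)) hs₂
      ?_ ?_ ?_).mono le_rfl fun s₃ hf₃ ⟨h4, h5⟩ => ?_
    · rw [hf₂.nat 13 (by decide), hf₁.nat 13 (by decide), hf.nat 13 (by decide), hJ]
    · rw [hf₂.nat 11 (by decide), ha, digit]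
    · rw [hb, digit, Nat.div_div_eq_div_mul, pow_succ]
    · have e : s₂.real 2 = s'.real 2 := by
        rw [hf₂.real 2 (by decide), hf₁.real 2 (by decide)]
      refine ⟨⟨?_, fun q hq => ?_⟩, fun j hj => ?_⟩
      · rw [hf₃.nat 7 (by decide), h7', Nat.div_div_eq_div_mul, Nat.div_div_eq_div_mul,
          show 2 * (k + 1) = 2 * k + 1 + 1 by ring, pow_succ, pow_succ, mul_assoc]
      · rw [h4 q hq, e, h2 q hq, Inst.diffSum, Inst.diffSum, Finset.sum_range_succ]
      · rw [h5 j hj, e, h3 j hj]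

/-- Store in variable `5` the squared norm of row `13`. -/
def sumSquares : Prog := setR 5 (.const 0) ⨟ forTo 9 1 (setR 5 (.add (rv 5) (.mul wCell wCell)))

theorem sumSquares_run {D : Inst} {s : Store} (hs : Loaded D s) {J : ℕ} (hJ : s.nat 13 0 0 = J)
    {g : ℕ → ℝ} (hg : ∀ q < D.d, s.real 2 J q = g q) :
    Run sumSquares s (D.d * (22 + 16) + 16) fun s' =>
      s'.real 5 0 0 = ∑ q ∈ Finset.range D.d, g q ^ 2 := by
  refine (Run.straight_seq rfl (Run.forTo (B := D.d) (T := 22)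
    (fun i s' => s'.real 5 0 0 = ∑ q ∈ Finset.range i, g q ^ 2)
    ?_ (by decide) (by decide) (by decide) ?_ ?_ ?_)).time ?_
  · simpa using hs.d
  · intro i s' x h; simpa using h
  · simp [RealExpr.eval]
  · rintro i s' hlt hf hi h
    refine (Run.straight rfl ?_).time (by decide)
    have e13 := hf.nat 13 (by decide)
    have e2 := hf.real 2 (by decide)
    simp only [setR_effect, Store.writeReal_nat] at e13
    rw [setR_effect, Store.writeReal_real_of_ne _ _ _ _ _ (by decide)] at e2
    simp [RealExpr.eval, wCell, e13, e2, hJ, hi, h, hg i hlt, Finset.sum_range_succ, sq]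
  · simp [Prog.cost, setR, RealExpr.size, NatExpr.size]
    omega

/-- Divide row `13` by its norm, the square of which is in variable `5`, and let the offset be
such that the boundary of the halfspace passes through the midpoint of points `11` and `12`. -/
def normaliseRow : Prog :=
  (setR 5 (.sqrt (rv 5)) ⨟ setR 4 (.const 0)) ⨟
  forTo 9 1 (.setReal 2 (nv 13) (nv 9) (.div wCell (rv 5)) ⨟
    setR 4 (.sub (rv 4) (.div (.mul wCell (.add (xCell 11) (xCell 12))) (.const 2)))) ⨟
  .setReal 3 (nv 13) (.const 0) (rv 4)

theorem normaliseRow_run {D : Inst} {s : Store} (hs : Loaded D s) {J a b : ℕ} {S : ℝ}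
    (hJ : s.nat 13 0 0 = J) (ha : s.nat 11 0 0 = a) (hb : s.nat 12 0 0 = b)
    (hS : s.real 5 0 0 = S) {g : ℕ → ℝ} (hg : ∀ q < D.d, s.real 2 J q = g q) :
    Run normaliseRow s (D.d * (50 + 16) + 50) fun s' =>
      ((∀ q < D.d, s'.real 2 J q = g q / √S) ∧
        s'.real 3 J 0 = ∑ q ∈ Finset.range D.d, -(g q / √S * (D.x a q + D.x b q) / 2)) ∧
      (∀ j ≠ J, s'.real 2 j = s.real 2 j) ∧ ∀ j ≠ J, s'.real 3 j = s.real 3 j := by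
  refine (Run.straight_seq rfl ((Run.forTo (B := D.d) (T := 50)
    (fun i s' => ((∀ q, s'.real 2 J q = if q < i then s.real 2 J q / √S else s.real 2 J q) ∧
        s'.real 4 0 0 = ∑ q ∈ Finset.range i, -(g q / √S * (D.x a q + D.x b q) / 2)) ∧
      (∀ j ≠ J, s'.real 2 j = s.real 2 j))
    ?_ (by decide) (by decide) (by decide) ?_ ?_ ?_).seq
      fun s' hf h => Run.straight rfl ?_)).time ?_
  · simpa [Prog.effect] using hs.d
  · intro i s' x h; simpa using h
  · simp [Prog.effect, RealExpr.eval]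
  · rintro i s' hlt hf hi ⟨⟨h1, h2⟩, h3⟩
    refine (Run.straight rfl ?_).time (by decide)
    have e13 := hf.nat 13 (by decide)
    have e11 := hf.nat 11 (by decide)
    have e12 := hf.nat 12 (by decide)
    have e5 : s'.real 5 0 0 = √S := by
      rw [hf.real 5 (by decide)]; simp [Prog.effect, RealExpr.eval, hS]
    have e1 : s'.real 1 = D.x := by
      rw [hf.real 1 (by decide)]; simp [Prog.effect, hs.x]
    simp only [Prog.effect, Store.writeReal_nat, setR_effect] at e13 e11 e12
    refine ⟨⟨fun q => ?_, ?_⟩, fun j hj => ?_⟩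
    · simp [Prog.effect, RealExpr.eval, wCell, e13, hJ, hi, e5]
      rcases lt_trichotomy q i with h | rfl | h
      · simp [h.ne, h1, h, h.not_gt]
      · simp [h1]
      · simp [h.ne', h1, h.not_gt, show ¬ q ≤ i by omega]
    · simp [Prog.effect, RealExpr.eval, wCell, xCell, e13, e11, e12, hJ, ha, hb, hi, e5,
        e1, h1, h2, hg i hlt, Finset.sum_range_succ]
      ring
    · funext q
      simp [Prog.effect, e13, hJ, hj, h3 j hj]
  · obtain ⟨⟨h1, h2⟩, h3⟩ := h
    have e13 := hf.nat 13 (by decide)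
    have e3 : s'.real 3 = s.real 3 := by
      rw [hf.real 3 (by decide)]; simp [Prog.effect]
    simp only [Prog.effect, Store.writeReal_nat, setR_effect] at e13
    refine ⟨⟨fun q hq => ?_, ?_⟩, fun j hj => ?_, fun j hj => ?_⟩
    · simp [Prog.effect, h1, hq, hg q hq]
    · simp [Prog.effect, NatExpr.eval, e13, hJ, h2]
    · simp [Prog.effect, h3 j hj]
    · funext q
      simp [Prog.effect, e13, hJ, hj, e3]
  · simp [Prog.cost, setR, RealExpr.size, NatExpr.size, rv, nv]
    omega

/-- Turn row `13`, which is zero, into the first unit vector, with an offset that makes the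
halfspace contain the whole unit ball or none of it, according to the label of point `11`. -/
def trivialRow : Prog :=
  .setReal 2 (nv 13) (.const 0) (.const 1) ⨟
  .setReal 3 (nv 13) (.const 0)
    (.sub (.mul (.const 4) (.ofNat (.cell 3 (nv 11) (.const 0)))) (.const 2))

/-- Decode from variable `7` the candidate halfspace number `J`, where `J` is the value of
variable `13`. -/
def buildRow : Prog :=
  clearRow ⨟ sumDiffs ⨟ popDigit 11 ⨟ popDigit 12 ⨟ sumSquares ⨟
  .cond (.realLt (.const 0) (rv 5)) normaliseRow trivialRow

/-- A bound for the running time of `buildRow`. -/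
def Inst.buildTime (D : Inst) (m : ℕ) : ℕ := 600 * (D.K + 1) * (m + D.d)

theorem buildRow_run {D : Inst} {s : Store} (hs : Loaded D s) {J m : ℕ}
    (hJ : s.nat 13 0 0 = J) (hm : s.nat 7 0 0 = m) :
    Run buildRow s (D.buildTime m) fun s' =>
      ((∀ q < D.d, s'.real 2 J q = D.candNormal (digit D.n m) q) ∧
        s'.real 3 J 0 = D.candOffset (digit D.n m)) ∧
      ((∀ j ≠ J, s'.real 2 j = s.real 2 j) ∧ ∀ j ≠ J, s'.real 3 j = s.real 3 j) ∧
      s'.nat 7 0 0 = m / D.n ^ D.len := by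
  have hm' : m / D.n ^ (2 * D.K) ≤ m := Nat.div_le_self _ _
  have hm'' : m / D.n ^ (2 * D.K) / D.n ≤ m := (Nat.div_le_self _ _).trans hm'
  have hd := D.d_pos
  refine ((clearRow_run hs hJ).seq fun s₁ f₁ ⟨h₁, h₁'⟩ => ?_).mono
    (T := (D.d * (8 + 16) + 12) + ((D.K * (54 * m + 46 * D.d + 62 + 16) + 12) + ((27 * m + 25) +
      ((27 * m + 25) + ((D.d * (22 + 16) + 16) + (6 + (D.d * (50 + 16) + 50))))))) ?_
      fun _ _ h => h
  rotate_left
  · have e1 : D.K ≤ D.K * D.d := Nat.le_mul_of_pos_right _ hd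
    have e2 : D.K * (54 * m + 46 * D.d + 62 + 16) =
        54 * (D.K * m) + 46 * (D.K * D.d) + 78 * D.K := by
      ring
    have e3 : D.buildTime m = 600 * (D.K * m) + 600 * (D.K * D.d) + 600 * m + 600 * D.d := by
      rw [Inst.buildTime]; ring
    rw [e2, e3]
    omega
  have hs₁ := hs.frame f₁ (by decide) (by decide)
  refine (sumDiffs_run hs₁ (J := J) (m := m) ?_ ?_ h₁).seq fun s₂ f₂ ⟨⟨h₂, h₂'⟩, h₂''⟩ => ?_
  · rw [f₁.nat 13 (by decide), hJ]
  · rw [f₁.nat 7 (by decide), hm]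
  have hs₂ := hs₁.frame f₂ (by decide) (by decide)
  refine (popDigit_run (dst := 11) hs₂ h₂ hm' (by decide) (by decide)).seq
    fun s₃ f₃ ⟨h₃, h₃'⟩ => ?_
  have hs₃ := hs₂.frame f₃ (by decide) (by decide)
  refine (popDigit_run (dst := 12) hs₃ h₃' hm'' (by decide) (by decide)).seq
    fun s₄ f₄ ⟨h₄, h₄'⟩ => ?_
  have hs₄ := hs₃.frame f₄ (by decide) (by decide)
  have e13 : s₄.nat 13 0 0 = J := by
    rw [f₄.nat 13 (by decide), f₃.nat 13 (by decide), f₂.nat 13 (by decide),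
      f₁.nat 13 (by decide), hJ]
  have e2 : s₄.real 2 = s₂.real 2 := by rw [f₄.real 2 (by decide), f₃.real 2 (by decide)]
  have e3 : s₄.real 3 = s.real 3 := by
    rw [f₄.real 3 (by decide), f₃.real 3 (by decide), f₂.real 3 (by decide),
      f₁.real 3 (by decide)]
  have e11 : s₄.nat 11 0 0 = digit D.n m (2 * D.K) := by rw [f₄.nat 11 (by decide), h₃, digit]
  have e12 : s₄.nat 12 0 0 = digit D.n m (2 * D.K + 1) := by
    rw [h₄, digit, Nat.div_div_eq_div_mul, pow_succ]
  have e7 : s₄.nat 7 0 0 = m / D.n ^ D.len := by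
    rw [h₄', Nat.div_div_eq_div_mul, Nat.div_div_eq_div_mul, Inst.len, pow_succ, pow_succ,
      mul_assoc]
  have hg : ∀ q < D.d, s₄.real 2 J q = D.diffSum (digit D.n m) D.K q := by rwa [e2]
  have hrest : ∀ j ≠ J, s₄.real 2 j = s.real 2 j := fun j hj => by
    rw [e2, h₂'' j hj, h₁' j hj]
  refine (sumSquares_run hs₄ e13 hg).seq fun s₅ f₅ h₅ => ?_
  have hs₅ := hs₄.frame f₅ (by decide) (by decide)
  have g2 := f₅.real 2 (by decide)
  have g3 := f₅.real 3 (by decide)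
  have g13 := f₅.nat 13 (by decide)
  have g11 := f₅.nat 11 (by decide)
  have g12 := f₅.nat 12 (by decide)
  have g7 := f₅.nat 7 (by decide)
  rw [← Inst.sqNorm] at h₅
  refine Run.cond (fun hc => ?_) fun hc => ?_ <;>
    simp only [Test.Holds, RealExpr.eval, rv_eval, h₅, Nat.cast_zero] at hc
  · refine (normaliseRow_run hs₅ (g13 ▸ e13) (g11 ▸ e11) (g12 ▸ e12) h₅ (g2 ▸ hg)).mono le_rfl
      fun s₆ f₆ ⟨⟨h₆, h₆'⟩, k₂, k₃⟩ => ⟨⟨fun q hq => ?_, ?_⟩, ⟨fun j hj => ?_, fun j hj => ?_⟩, ?_⟩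
    · rw [h₆ q hq, Inst.candNormal, if_pos hc]
    · rw [h₆', Inst.candOffset, if_pos hc]
      simp only [Inst.candNormal, if_pos hc]
    · rw [k₂ j hj, g2, hrest j hj]
    · rw [k₃ j hj, g3, e3]
    · rw [f₆.nat 7 (by decide), g7, e7]
  · have hz : ∀ q < D.d, D.diffSum (digit D.n m) D.K q = 0 := fun q hq =>
      pow_eq_zero_iff (two_ne_zero) |>.1 ((Finset.sum_eq_zero_iff_of_nonneg
        fun q _ => sq_nonneg _).1 (le_antisymm (not_lt.1 hc)
          (Finset.sum_nonneg fun q _ => sq_nonneg _)) q (Finset.mem_range.2 hq))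
    refine (Run.straight rfl ⟨⟨fun q hq => ?_, ?_⟩, ⟨fun j hj => ?_, fun j hj => ?_⟩, ?_⟩).time ?_
    · have : trivialRow.cost ≤ 24 := by decide
      omega
    · have := hg q hq
      rw [hz q hq] at this
      simp [trivialRow, Prog.effect, RealExpr.eval, NatExpr.eval, g13, e13, g2, this,
        Inst.candNormal, hc]
    · simp [trivialRow, Prog.effect, RealExpr.eval, NatExpr.eval, g13, e13, g11, e11,
        Inst.candOffset, hc, hs₅.y]
    · funext q
      simp [trivialRow, Prog.effect, g13, e13, g2, hj, hrest j hj]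
    · funext q
      simp [trivialRow, Prog.effect, g13, e13, g3, e3, hj]
    · simp [trivialRow, Prog.effect, g7, e7]

/-! ### Candidates and their codes -/

namespace Inst

variable (D : Inst)

theorem diffSum_congr {f g : ℕ → ℕ} (h : ∀ k < D.len, f k = g k) (q : ℕ) :
    D.diffSum f D.K q = D.diffSum g D.K q := by
  refine Finset.sum_congr rfl fun l hl => ?_
  have := Finset.mem_range.1 hl
  rw [h (2 * l) (by rw [len]; omega), h (2 * l + 1) (by rw [len]; omega)]

theorem sqNorm_congr {f g : ℕ → ℕ} (h : ∀ k < D.len, f k = g k) : D.sqNorm f = D.sqNorm g := by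
  simp only [sqNorm, D.diffSum_congr h]

theorem candNormal_congr {f g : ℕ → ℕ} (h : ∀ k < D.len, f k = g k) (q : ℕ) :
    D.candNormal f q = D.candNormal g q := by
  rw [candNormal, candNormal, D.sqNorm_congr h, D.diffSum_congr h]

theorem candValue_congr {f g : ℕ → ℕ} (h : ∀ k < D.len, f k = g k) (i : ℕ) :
    D.candValue f i = D.candValue g i := by
  rw [candValue, candValue, candOffset, candOffset, D.sqNorm_congr h,
    h (2 * D.K) (by rw [len]; omega), h (2 * D.K + 1) (by rw [len]; omega)]
  simp only [D.candNormal_congr h]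

theorem sum_candNormal_sq (f : ℕ → ℕ) :
    ∑ q ∈ Finset.range D.d, D.candNormal f q ^ 2 = 1 := by
  by_cases h : 0 < D.sqNorm f
  · simp only [candNormal, if_pos h, div_pow, Real.sq_sqrt h.le, ← Finset.sum_div]
    exact div_self h.ne'
  · simp only [candNormal, if_neg h]
    simp [D.d_pos]

/-- Point `i` is classified correctly, with margin `γ / 4`, by `r` halfspaces whose affine
functions take the values `v 0, …, v (r - 1)` at this point. -/
def Ok (r : ℕ) (v : ℕ → ℝ) (i : ℕ) : Prop :=
  if 0 < D.y i then ∀ j < r, D.γ / 4 < v j else ∃ j < r, v j < -(D.γ / 4)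

/-- Some `D.t` candidate halfspaces together classify all points correctly. -/
def Coverable : Prop :=
  ∃ f : ℕ → ℕ → ℕ, (∀ j k, f j k < D.n) ∧
    ∀ i < D.n, D.Ok D.t (fun j => D.candValue (f j) i) i

/-- The value at point `i` of the affine function stored in row `j`. -/
noncomputable def rowValue (s : Store) (j i : ℕ) : ℝ :=
  s.real 3 j 0 + ∑ q ∈ Finset.range D.d, s.real 2 j q * D.x i q

/-- Row `j` of the store holds the candidate halfspace with index list `f`. -/
def HoldsCand (s : Store) (j : ℕ) (f : ℕ → ℕ) : Prop :=
  (∀ q < D.d, s.real 2 j q = D.candNormal f q) ∧ s.real 3 j 0 = D.candOffset f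

theorem HoldsCand.rowValue {D : Inst} {s : Store} {j : ℕ} {f : ℕ → ℕ} (h : D.HoldsCand s j f)
    (i : ℕ) : D.rowValue s j i = D.candValue f i := by
  rw [Inst.rowValue, candValue, h.2]
  congr 1
  exact Finset.sum_congr rfl fun q hq => by rw [h.1 q (Finset.mem_range.1 hq)]

theorem HoldsCand.sum_sq {D : Inst} {s : Store} {j : ℕ} {f : ℕ → ℕ} (h : D.HoldsCand s j f) :
    ∑ q ∈ Finset.range D.d, s.real 2 j q ^ 2 = 1 := by
  rw [← D.sum_candNormal_sq f]
  exact Finset.sum_congr rfl fun q hq => by rw [h.1 q (Finset.mem_range.1 hq)]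

/-- The store holds a polytope with `r` halfspaces that is consistent with the points. -/
def Solved (r : ℕ) (s : Store) : Prop :=
  s.nat 4 0 0 = r ∧ (∀ j < r, ∑ q ∈ Finset.range D.d, s.real 2 j q ^ 2 = 1) ∧
    ∀ i < D.n, D.Ok r (fun j => D.rowValue s j i) i

end Inst

/-- Every list of digits is encoded by some number. -/
theorem exists_code {n : ℕ} {f : ℕ → ℕ} (hf : ∀ k, f k < n) (L : ℕ) :
    ∃ m < n ^ L, ∀ k < L, digit n m k = f k := by
  refine ⟨finFunctionFinEquiv fun k : Fin L => (⟨f k, hf k⟩ : Fin n),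
    (finFunctionFinEquiv _).is_lt, fun k hk => ?_⟩
  have := congrFun (finFunctionFinEquiv.symm_apply_apply
    fun k : Fin L => (⟨f k, hf k⟩ : Fin n)) ⟨k, hk⟩
  exact congrArg Fin.val this

theorem digit_div (n m a k : ℕ) : digit n (m / n ^ a) k = digit n m (a + k) := by
  rw [digit, digit, Nat.div_div_eq_div_mul, pow_add]

/-! ### Evaluating halfspaces -/

/-- Store in variable `6` the value of row `13` at point `14`. -/
def evalRow : Prog :=
  setR 6 (.cell 3 (nv 13) (.const 0)) ⨟
  forTo 9 1 (setR 6 (.add (rv 6) (.mul wCell (xCell 14))))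

theorem evalRow_run {D : Inst} {s : Store} (hs : Loaded D s) {j i : ℕ}
    (hj : s.nat 13 0 0 = j) (hi : s.nat 14 0 0 = i) :
    Run evalRow s (38 * D.d + 20) fun s' => s'.real 6 0 0 = D.rowValue s j i := by
  refine (Run.straight_seq rfl (Run.forTo (B := D.d) (T := 22)
    (fun k s' => s'.real 6 0 0 = s.real 3 j 0 + ∑ q ∈ Finset.range k, s.real 2 j q * D.x i q)
    ?_ (by decide) (by decide) (by decide) ?_ ?_ ?_)).time ?_
  · simpa using hs.d
  · intro i s' x h; simpa using h
  · simp [RealExpr.eval, NatExpr.eval, hj]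
  · rintro k s' hlt hf hk h
    refine (Run.straight rfl ?_).time (by decide)
    have e13 := hf.nat 13 (by decide)
    have e14 := hf.nat 14 (by decide)
    have e2 := hf.real 2 (by decide)
    have e1 : s'.real 1 = D.x := by
      rw [hf.real 1 (by decide)]; simpa using hs.x
    simp only [setR_effect, Store.writeReal_nat] at e13 e14
    rw [setR_effect, Store.writeReal_real_of_ne _ _ _ _ _ (by decide)] at e2
    simp [RealExpr.eval, wCell, xCell, e13, e14, e1, e2, hj, hi, hk, h, Finset.sum_range_succ,
      add_assoc]
  · simp [Prog.cost, setR, RealExpr.size, NatExpr.size, nv]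
    omega

/-- A quarter of the margin. -/
def quarter : RealExpr := .div (rv 0) (.const 4)

/-- The label of the current point. -/
def labelCell : NatExpr := .cell 3 (nv 14) (.const 0)

/-- Set variable `15` to `0` if the rows stored form a consistent polytope, otherwise to `1`. -/
def checkAll : Prog :=
  setN 15 (.const 0) ⨟
  forTo 14 0 (
    setN 17 (.const 0) ⨟
    forTo 13 4 (evalRow ⨟
      .cond (.natLt (.const 0) labelCell)
        (.cond (.realLt quarter (rv 6)) .skip (setN 15 (.const 1)))
        (.cond (.realLt (rv 6) (.sub (.const 0) quarter)) (setN 17 (.const 1)) .skip)) ⨟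
    .cond (.natLt (.const 0) labelCell) .skip
      (.cond (.natLt (.const 0) (nv 17)) .skip (setN 15 (.const 1))))

theorem checkAll_run {D : Inst} {s : Store} (hs : Loaded D s) {r : ℕ} (hr : s.nat 4 0 0 = r) :
    Run checkAll s (D.n * ((r * ((38 * D.d + 20 + 40) + 16) + 36) + 16) + 16) fun s' =>
      s'.nat 15 0 0 = 0 ↔ ∀ i < D.n, D.Ok r (fun j => D.rowValue s j i) i := by
  have hs₀ : Loaded D ((setN 15 (.const 0)).effect s) :=
    hs.frame (Frame.effect rfl s) (by decide) (by decide)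
  refine (Run.straight_seq rfl (Run.forTo (B := D.n)
    (T := 4 + ((r * ((38 * D.d + 20 + 40) + 16) + 12) + 20))
    (fun i s' => s'.nat 15 0 0 = 0 ↔ ∀ i' < i, D.Ok r (fun j => D.rowValue s j i') i')
    hs₀.n (by decide) (by decide) (by decide) ?_ ?_ ?_)).time ?_
  · intro i s' x h; simpa using h
  · simp [NatExpr.eval]
  · rintro i s' hi hf h14 h
    have hs' := hs₀.frame hf (by decide) (by decide)
    have e2 := hf.real 2 (by decide)
    have e3 := hf.real 3 (by decide)
    have e4 := hf.nat 4 (by decide)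
    simp only [setN_effect, Store.writeNat_real] at e2 e3
    rw [setN_effect, Store.writeNat_nat_of_ne _ _ _ _ _ (by decide)] at e4
    have hs₁ : Loaded D ((setN 17 (.const 0)).effect s') :=
      hs'.frame (Frame.effect rfl s') (by decide) (by decide)
    have key : Run (forTo 13 4 _) ((setN 17 (.const 0)).effect s') _ _ := Run.forTo (B := r)
      (p := evalRow ⨟ .cond (.natLt (.const 0) labelCell)
        (.cond (.realLt quarter (rv 6)) .skip (setN 15 (.const 1)))
        (.cond (.realLt (rv 6) (.sub (.const 0) quarter)) (setN 17 (.const 1)) .skip))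
      (T := 38 * D.d + 20 + 40)
      (fun j s'' => (s''.nat 15 0 0 = 0 ↔ s'.nat 15 0 0 = 0 ∧
          (0 < D.y i → ∀ j' < j, D.γ / 4 < D.rowValue s j' i)) ∧
        (¬ 0 < D.y i → (0 < s''.nat 17 0 0 ↔ ∃ j' < j, D.rowValue s j' i < -(D.γ / 4))))
      ?_ (by decide) (by decide) (by decide) ?_ ?_ ?_
    · refine Run.straight_seq rfl (key.seq fun s₂ f₂ ⟨h₂, h₂'⟩ =>
        (Run.straight rfl ?_).time (by decide))
      have hs₂ := hs₁.frame f₂ (by decide) (by decide)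
      have e14 : s₂.nat 14 0 0 = i := by rw [f₂.nat 14 (by decide)]; simpa using h14
      rw [Nat.forall_lt_succ_right, ← h, Inst.Ok]
      by_cases hy : 0 < D.y i
      · simp [Prog.effect, Test.Holds, NatExpr.eval, labelCell, e14, hs₂.y, hy, h₂]
      · simp only [hy, IsEmpty.forall_iff, and_true, not_false_eq_true, forall_const] at h₂ h₂'
        rw [if_neg hy, ← h₂', ← h₂]
        by_cases h17 : 0 < s₂.nat 17 0 0 <;>
          simp [Prog.effect, Test.Holds, NatExpr.eval, labelCell, e14, hs₂.y, hy, h17]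
    · simp [e4, hr]
    · intro i s' x h; simpa using h
    · simp [NatExpr.eval]
    · rintro j s₂ hj f₂ h13 ⟨h₂, h₂'⟩
      have hs₂ := hs₁.frame f₂ (by decide) (by decide)
      have e14 : s₂.nat 14 0 0 = i := by rw [f₂.nat 14 (by decide)]; simpa using h14
      refine (evalRow_run hs₂ h13 e14).seq fun s₃ f₃ h₃ => (Run.straight rfl ?_).time (by decide)
      have hs₃ := hs₂.frame f₃ (by decide) (by decide)
      have e14' : s₃.nat 14 0 0 = i := by rw [f₃.nat 14 (by decide), e14]
      have e15 : s₃.nat 15 = s₂.nat 15 := f₃.nat 15 (by decide)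
      have e17 : s₃.nat 17 = s₂.nat 17 := f₃.nat 17 (by decide)
      have hv : s₃.real 6 0 0 = D.rowValue s j i := by
        rw [h₃, Inst.rowValue, Inst.rowValue, f₂.real 2 (by decide), f₂.real 3 (by decide)]
        simp [e2, e3]
      rw [Nat.forall_lt_succ_right, Nat.exists_lt_succ_right]
      by_cases hy : 0 < D.y i
      · by_cases hc : D.γ / 4 < D.rowValue s j i <;>
          simp [Prog.effect, Test.Holds, NatExpr.eval, RealExpr.eval, labelCell, quarter, e14',
            hs₃.y, hs₃.γ, hy, hv, hc, e15, h₂]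
      · by_cases hc : D.rowValue s j i < -(D.γ / 4)
        · simp [Prog.effect, Test.Holds, NatExpr.eval, RealExpr.eval, labelCell, quarter, e14',
            hs₃.y, hs₃.γ, hy, hv, hc, e15, h₂]
        · simpa [Prog.effect, Test.Holds, NatExpr.eval, RealExpr.eval, labelCell, quarter, e14',
            hs₃.y, hs₃.γ, hy, hv, hc, e15, e17, h₂] using h₂'
  · simp [Prog.cost, setN, NatExpr.size]
    ring_nf
    rfl

/-! ### The parameter of the search -/

/-- Store in variable `5`, which is `0` before, the least `K` with `3 ≤ K γ²`. -/
def computeK : Prog :=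
  .loop (.realLt (.mul (.ofNat (nv 5)) (.mul (rv 0) (rv 0))) (.const 3))
    (setN 5 (.add (nv 5) (.const 1)))

theorem computeK_run {s : Store} {γ : ℝ} (hγ : 0 < γ) (h0 : s.real 0 0 0 = γ)
    (h5 : s.nat 5 0 0 = 0) :
    Run computeK s (23 * ⌈3 / γ ^ 2⌉₊ + 15) fun s' => s'.nat 5 0 0 = ⌈3 / γ ^ 2⌉₊ := by
  have hγ2 : 0 < γ ^ 2 := by positivity
  refine (Run.loop (T := 8) (fun s' => s'.real 0 0 0 = γ ∧ s'.nat 5 0 0 ≤ ⌈3 / γ ^ 2⌉₊)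
    (fun s' => ⌈3 / γ ^ 2⌉₊ - s'.nat 5 0 0) ?_ ?_ (Nat.sub_le _ _) (k := 15) rfl).mono ?_ ?_
  · rintro s' ⟨h, hle⟩ hlt
    refine (Run.straight rfl ?_).time (by decide)
    simp only [Test.Holds, RealExpr.eval, nv_eval, rv_eval, h] at hlt
    have : s'.nat 5 0 0 < ⌈3 / γ ^ 2⌉₊ := by
      rw [Nat.lt_ceil, lt_div_iff₀ hγ2, sq]
      simpa using hlt
    simp [NatExpr.eval, h]
    omega
  · exact ⟨h0, by omega⟩
  · omega
  · rintro s' - ⟨⟨h, hle⟩, hlt⟩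
    refine le_antisymm hle ?_
    simp only [Test.Holds, RealExpr.eval, nv_eval, rv_eval, h, not_lt] at hlt
    rw [Nat.ceil_le, div_le_iff₀ hγ2, sq]
    simpa using hlt

/-! ### Exhaustive search for a polytope with the given number of halfspaces -/

/-- Decode all halfspaces from variable `6`. -/
def buildAll : Prog := setN 7 (nv 6) ⨟ forTo 13 4 buildRow

theorem buildAll_run {D : Inst} {s : Store} (hs : Loaded D s) {r m : ℕ} (hr : s.nat 4 0 0 = r)
    (hm : s.nat 6 0 0 = m) :
    Run buildAll s (r * (D.buildTime m + 16) + 18) fun s' =>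
      ∀ j < r, D.HoldsCand s' j fun k => digit D.n m (D.len * j + k) := by
  have hs₀ : Loaded D ((setN 7 (nv 6)).effect s) :=
    hs.frame (Frame.effect rfl s) (by decide) (by decide)
  have key : Run (forTo 13 4 buildRow) ((setN 7 (nv 6)).effect s) _ _ := Run.forTo (B := r)
    (T := D.buildTime m)
    (fun J s' => s'.nat 7 0 0 = m / D.n ^ (D.len * J) ∧
      ∀ j < J, D.HoldsCand s' j fun k => digit D.n m (D.len * j + k))
    ?_ (by decide) (by decide) (by decide) ?_ ?_ ?_
  · refine (Run.straight_seq rfl key).mono ?_ ?_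
    · simp [Prog.cost, setN, NatExpr.size, nv]
      omega
    · rintro s' - ⟨-, h⟩
      exact h
  · simp [hr]
  · intro i s' x h; simpa [Inst.HoldsCand] using h
  · simp [hm]
  · rintro J s' hJ hf h13 ⟨h, h'⟩
    have hs' := hs₀.frame hf (by decide) (by decide)
    refine (buildRow_run hs' h13 h).mono ?_ ?_
    · exact Nat.mul_le_mul_left _ (Nat.add_le_add_right (Nat.div_le_self _ _) _)
    · rintro s'' - ⟨h₁, ⟨h₂, h₃⟩, h₄⟩
      refine ⟨?_, fun j hj => ?_⟩
      · rw [h₄, Nat.div_div_eq_div_mul, ← pow_add, Nat.mul_succ]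
      · rcases (Nat.lt_succ_iff.1 hj).lt_or_eq with hj | rfl
        · refine ⟨fun q hq => ?_, ?_⟩
          · rw [h₂ j hj.ne, (h' j hj).1 q hq]
          · rw [h₃ j hj.ne, (h' j hj).2]
        · have : (fun k => digit D.n m (D.len * j + k)) = digit D.n (m / D.n ^ (D.len * j)) :=
            funext fun k => (digit_div _ _ _ _).symm
          rw [this]
          exact h₁

/-- Try all codes of `t` candidate halfspaces in turn, until they form a consistent polytope. -/
def exhaustiveSearch : Prog :=
  computeK ⨟ (setN 4 (nv 2) ⨟ setN 15 (.const 1)) ⨟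
  .loop (.natLt (.const 0) (nv 15)) (buildAll ⨟ checkAll ⨟ setN 6 (.add (nv 6) (.const 1)))

theorem exhaustiveSearch_loop {D : Inst} (hD : D.Coverable) {s : Store} (hs : Loaded D s)
    (h4 : s.nat 4 0 0 = D.t) (h6 : s.nat 6 0 0 = 0) (h15 : s.nat 15 0 0 = 1) {A : ℕ}
    (hA : A = D.n ^ (D.len * D.t)) :
    Run (.loop (.natLt (.const 0) (nv 15))
        (buildAll ⨟ checkAll ⨟ setN 6 (.add (nv 6) (.const 1)))) s
      (A * ((D.t * (D.buildTime A + 16) + 18) +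
        ((D.n * ((D.t * ((38 * D.d + 20 + 40) + 16) + 36) + 16) + 16) + 8) + 6) + 6)
      (D.Solved D.t) := by
  obtain ⟨f, hf, hok⟩ := hD
  have hl : 0 < D.len := by simp [Inst.len]
  obtain ⟨N, hN, hNd⟩ := exists_code (f := fun k => f (k / D.len) (k % D.len))
    (fun k => hf _ _) (D.len * D.t)
  rw [← hA] at hN
  have hNf : ∀ j < D.t, ∀ k < D.len, digit D.n N (D.len * j + k) = f j k := by
    intro j hj k hk
    rw [hNd, Nat.mul_add_div hl, Nat.div_eq_of_lt hk, Nat.mul_add_mod, Nat.mod_eq_of_lt hk,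
      add_zero]
    calc D.len * j + k < D.len * j + D.len := by omega
      _ = D.len * (j + 1) := by ring
      _ ≤ D.len * D.t := Nat.mul_le_mul_left _ hj
  refine (Run.loop
    (fun s' => (Loaded D s' ∧ s'.nat 4 0 0 = D.t) ∧
      ((s'.nat 15 0 0 = 0 ∧ D.Solved D.t s') ∨ (s'.nat 15 0 0 ≠ 0 ∧ s'.nat 6 0 0 ≤ N)))
    (fun s' => if s'.nat 15 0 0 = 0 then 0 else N + 1 - s'.nat 6 0 0)
    (T := (D.t * (D.buildTime A + 16) + 18) +
        ((D.n * ((D.t * ((38 * D.d + 20 + 40) + 16) + 36) + 16) + 16) + 8))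
    ?_ ?_ (B := A) ?_ (k := 6) rfl).mono le_rfl ?_
  · rintro s' ⟨⟨hs', h4'⟩, h⟩ hlt
    simp only [Test.Holds, NatExpr.eval, nv_eval] at hlt
    obtain ⟨-, hle⟩ := h.resolve_left (by omega)
    have hmono : D.buildTime (s'.nat 6 0 0) ≤ D.buildTime A :=
      Nat.mul_le_mul_left _ (by omega)
    refine ((buildAll_run hs' h4' rfl).time (Nat.add_le_add_right (Nat.mul_le_mul_left _
      (Nat.add_le_add_right hmono _)) _)).seq fun s₁ f₁ h₁ => ?_
    have hs₁ := hs'.frame f₁ (by decide) (by decide)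
    have h4₁ : s₁.nat 4 0 0 = D.t := by rw [f₁.nat 4 (by decide), h4']
    refine (checkAll_run hs₁ h4₁).seq fun s₂ f₂ h₂ => (Run.straight rfl ?_).time (by decide)
    have hs₂ := hs₁.frame f₂ (by decide) (by decide)
    have h4₂ : s₂.nat 4 0 0 = D.t := by rw [f₂.nat 4 (by decide), h4₁]
    have h6₂ : s₂.nat 6 0 0 = s'.nat 6 0 0 := by
      rw [f₂.nat 6 (by decide), f₁.nat 6 (by decide)]
    have hs₃ : Loaded D ((setN 6 (.add (nv 6) (.const 1))).effect s₂) :=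
      hs₂.frame (Frame.effect rfl s₂) (by decide) (by decide)
    refine ⟨⟨⟨hs₃, by simp [h4₂]⟩, ?_⟩, ?_⟩
    · by_cases hz : s₂.nat 15 0 0 = 0
      · refine Or.inl ⟨by simp [hz], by simp [h4₂], fun j hj => ?_, ?_⟩
        · rw [← (h₁ j hj).sum_sq]
          simp [f₂.real 2 (by decide)]
        · simpa [Inst.rowValue, f₂.real 2 (by decide), f₂.real 3 (by decide)] using h₂.1 hz
      · refine Or.inr ⟨by simp [hz], ?_⟩
        -- The code `N` itself would have passed the check.
        have hne : s'.nat 6 0 0 ≠ N := by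
          intro he
          refine hz (h₂.2 fun i hi => ?_)
          have hoki := hok i hi
          have hval : ∀ j < D.t, D.rowValue s₁ j i = D.candValue (f j) i := fun j hj => by
            rw [(h₁ j hj).rowValue, he, D.candValue_congr (hNf j hj)]
          unfold Inst.Ok at hoki ⊢
          split_ifs at hoki ⊢ with hy
          · exact fun j hj => (hoki j hj).trans_eq (hval j hj).symm
          · obtain ⟨j, hj, h⟩ := hoki
            exact ⟨j, hj, (hval j hj).trans_lt h⟩
        simp [NatExpr.eval, h6₂]
        omega
    · simp [NatExpr.eval, h6₂]
      split_ifs <;> omega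
  · exact ⟨⟨hs, h4⟩, Or.inr ⟨by omega, by omega⟩⟩
  · simpa [h15, h6] using hN
  · rintro s' - ⟨⟨-, h⟩, hlt⟩
    simp only [Test.Holds, NatExpr.eval, nv_eval] at hlt
    rcases h with h | h
    · exact h.2
    · omega

/-! ### Greedy covering -/

namespace Inst

variable (D : Inst)

/-- The total weight, under `u`, of the points at which `v` is below minus a quarter of the
margin. -/
noncomputable def covered (v : ℕ → ℝ) (u : ℕ → ℕ) (k : ℕ) : ℕ :=
  ∑ i ∈ Finset.range k, if v i < -(D.γ / 4) then u i else 0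

/-- The halfspace with values `v` contains all positive points, and it excludes at least a
fraction `1 / D.t` of the negative points that are marked by `u`. -/
def Useful (u : ℕ → ℕ) (v : ℕ → ℝ) : Prop :=
  (∀ i < D.n, 0 < D.y i → D.γ / 4 < v i) ∧
    ∑ i ∈ Finset.range D.n, u i ≤ D.covered v u D.n * D.t

/-- By the pigeonhole principle, one of `t` halfspaces that exclude all marked points excludes at
least a fraction `1 / t` of them. -/
theorem Coverable.exists_useful {D : Inst} (hD : D.Coverable) {u : ℕ → ℕ}
    (hu : ∀ i < D.n, 0 < D.y i → u i = 0) (ht : 0 < D.t) :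
    ∃ f : ℕ → ℕ, (∀ k, f k < D.n) ∧ D.Useful u (D.candValue f) := by
  obtain ⟨f, hf, hok⟩ := hD
  have hpos : ∀ j < D.t, ∀ i < D.n, 0 < D.y i → D.γ / 4 < D.candValue (f j) i := by
    intro j hj i hi hy
    have := hok i hi
    rw [Inst.Ok, if_pos hy] at this
    exact this j hj
  have hsum : ∑ i ∈ Finset.range D.n, u i ≤
      ∑ j ∈ Finset.range D.t, D.covered (D.candValue (f j)) u D.n := by
    simp only [covered]
    rw [Finset.sum_comm]
    refine Finset.sum_le_sum fun i hi => ?_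
    have hi := Finset.mem_range.1 hi
    rcases Nat.eq_zero_or_pos (D.y i) with hy | hy
    · have := hok i hi
      rw [Inst.Ok, if_neg (by omega)] at this
      obtain ⟨j, hj, h⟩ := this
      refine le_trans ?_ (Finset.single_le_sum (fun _ _ => Nat.zero_le _) (Finset.mem_range.2 hj))
      rw [if_pos h]
    · rw [hu i hi hy]
      exact Nat.zero_le _
  by_contra! hcon
  have hlt : ∀ j ∈ Finset.range D.t, D.covered (D.candValue (f j)) u D.n * D.t <
      ∑ i ∈ Finset.range D.n, u i := by
    intro j hj
    by_contra! hle
    exact hcon (f j) (hf j) ⟨hpos j (Finset.mem_range.1 hj), hle⟩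
  have := Finset.sum_lt_sum_of_nonempty (Finset.nonempty_range_iff.2 ht.ne') hlt
  rw [← Finset.sum_mul, Finset.sum_const, Finset.card_range, smul_eq_mul, mul_comm] at this
  exact absurd (Nat.lt_of_mul_lt_mul_left this) (not_lt.2 hsum)

end Inst

/-- Set variable `15` to `0` if row `13` is useful for the marks in table `20`, otherwise to `1`;
store in variable `18` the number of marked points that it excludes. -/
def checkRow : Prog :=
  (setN 15 (.const 0) ⨟ setN 18 (.const 0)) ⨟
  forTo 14 0 (evalRow ⨟
    .cond (.natLt (.const 0) labelCell)
      (.cond (.realLt quarter (rv 6)) .skip (setN 15 (.const 1))) .skip ⨟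
    .cond (.realLt (rv 6) (.sub (.const 0) quarter))
      (setN 18 (.add (nv 18) (.cell 20 (nv 14) (.const 0)))) .skip) ⨟
  .cond (.realLt (.mul (.ofNat (nv 18)) (.ofNat (nv 2))) (.ofNat (nv 19))) (setN 15 (.const 1))
    .skip

theorem checkRow_run {D : Inst} {s : Store} (hs : Loaded D s) {j : ℕ}
    (hj : s.nat 13 0 0 = j)
    (hR : s.nat 19 0 0 = ∑ i ∈ Finset.range D.n, s.nat 20 i 0) :
    Run checkRow s (8 + (D.n * (38 * D.d + 20 + 60 + 16) + 12 + 30)) fun s' =>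
      (s'.nat 15 0 0 = 0 ↔ D.Useful (fun i => s.nat 20 i 0) (D.rowValue s j)) ∧
      s'.nat 18 0 0 = D.covered (D.rowValue s j) (fun i => s.nat 20 i 0) D.n := by
  have hs₀ : Loaded D ((setN 15 (.const 0) ⨟ setN 18 (.const 0)).effect s) :=
    hs.frame (Frame.effect rfl s) (by decide) (by decide)
  refine (Run.straight_seq rfl ((Run.forTo (B := D.n) (T := 38 * D.d + 20 + 60)
    (fun i s' => (s'.nat 15 0 0 = 0 ↔ ∀ i' < i, 0 < D.y i' → D.γ / 4 < D.rowValue s j i') ∧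
      s'.nat 18 0 0 = D.covered (D.rowValue s j) (fun i => s.nat 20 i 0) i)
    hs₀.n (by decide) (by decide) (by decide) ?_ ?_ ?_).seq fun s' hf ⟨h, h'⟩ =>
      (Run.straight rfl ?_).time (T' := 30) (by decide))).time ?_
  · intro i s' x h; simpa using h
  · simp [Prog.effect, NatExpr.eval, Inst.covered]
  · rintro i s' hi hf h14 ⟨h, h'⟩
    have hs' := hs₀.frame hf (by decide) (by decide)
    have e13 : s'.nat 13 0 0 = j := by rw [hf.nat 13 (by decide)]; simpa [Prog.effect] using hj
    refine (evalRow_run hs' e13 h14).seq fun s₁ f₁ h₁ => (Run.straight rfl ?_).time (by decide)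
    have hs₁ := hs'.frame f₁ (by decide) (by decide)
    have e14 : s₁.nat 14 0 0 = i := by rw [f₁.nat 14 (by decide), h14]
    have e15 : s₁.nat 15 = s'.nat 15 := f₁.nat 15 (by decide)
    have e18 : s₁.nat 18 = s'.nat 18 := f₁.nat 18 (by decide)
    have e20 : s₁.nat 20 = s.nat 20 := by
      rw [f₁.nat 20 (by decide), hf.nat 20 (by decide)]; simp [Prog.effect]
    have hv : s₁.real 6 0 0 = D.rowValue s j i := by
      rw [h₁, Inst.rowValue, Inst.rowValue, hf.real 2 (by decide), hf.real 3 (by decide)]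
      simp [Prog.effect]
    rw [Nat.forall_lt_succ_right, ← h, Inst.covered, Finset.sum_range_succ, ← Inst.covered, ← h']
    by_cases hy : 0 < D.y i <;> by_cases hc : D.γ / 4 < D.rowValue s j i <;>
      by_cases hc' : D.rowValue s j i < -(D.γ / 4) <;>
      simp [Prog.effect, Test.Holds, NatExpr.eval, RealExpr.eval, labelCell, quarter, e14,
        hs₁.y, hs₁.γ, hy, hv, hc, hc', e15, e18, e20]
  · have hs' := hs₀.frame hf (by decide) (by decide)
    have e19 : s'.nat 19 0 0 = ∑ i ∈ Finset.range D.n, s.nat 20 i 0 := by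
      rw [hf.nat 19 (by decide)]; simpa [Prog.effect] using hR
    have hiff : ((s'.nat 18 0 0 : ℝ) * (s'.nat 2 0 0 : ℝ) < (s'.nat 19 0 0 : ℝ)) ↔
        s'.nat 18 0 0 * s'.nat 2 0 0 < s'.nat 19 0 0 := by exact_mod_cast Iff.rfl
    rw [Inst.Useful, ← h, ← h', ← e19, ← hs'.t]
    by_cases hc : s'.nat 18 0 0 * s'.nat 2 0 0 < s'.nat 19 0 0
    · simp [Prog.effect, Test.Holds, NatExpr.eval, RealExpr.eval, hiff, hc]
    · simp [Prog.effect, Test.Holds, RealExpr.eval, hiff, hc, not_lt.1 hc]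
  · have : (setN 15 (.const 0) ⨟ setN 18 (.const 0)).cost = 8 := rfl
    omega

/-- Search for a useful halfspace and store it in row `13`. -/
def findRow : Prog :=
  (setN 6 (.const 0) ⨟ setN 15 (.const 1)) ⨟
  .loop (.natLt (.const 0) (nv 15))
    (setN 7 (nv 6) ⨟ buildRow ⨟ checkRow ⨟ setN 6 (.add (nv 6) (.const 1)))

/-- A bound for the running time of `findRow`. -/
def Inst.findTime (D : Inst) : ℕ :=
  14 + D.n ^ D.len * (6 + (D.buildTime (D.n ^ D.len) +
    (8 + (D.n * (38 * D.d + 20 + 60 + 16) + 12 + 30) + 8)) + 6)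

theorem findRow_run {D : Inst} (hD : D.Coverable) (ht : 0 < D.t) {s : Store} (hs : Loaded D s)
    {J : ℕ} (hJ : s.nat 13 0 0 = J)
    (hR : s.nat 19 0 0 = ∑ i ∈ Finset.range D.n, s.nat 20 i 0)
    (hu : ∀ i < D.n, 0 < D.y i → s.nat 20 i 0 = 0) :
    Run findRow s D.findTime fun s' =>
      (∑ q ∈ Finset.range D.d, s'.real 2 J q ^ 2 = 1 ∧
        D.Useful (fun i => s.nat 20 i 0) (D.rowValue s' J)) ∧
      ((∀ j ≠ J, s'.real 2 j = s.real 2 j) ∧ ∀ j ≠ J, s'.real 3 j = s.real 3 j) ∧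
      s'.nat 18 0 0 = D.covered (D.rowValue s' J) (fun i => s.nat 20 i 0) D.n := by
  obtain ⟨f, hf, huse⟩ := hD.exists_useful hu ht
  obtain ⟨N, hN, hNd⟩ := exists_code hf D.len
  have hs₀ : Loaded D ((setN 6 (.const 0) ⨟ setN 15 (.const 1)).effect s) :=
    hs.frame (Frame.effect rfl s) (by decide) (by decide)
  have key := Run.loop (c := .natLt (.const 0) (nv 15))
    (p := setN 7 (nv 6) ⨟ buildRow ⨟ checkRow ⨟ setN 6 (.add (nv 6) (.const 1)))
    (fun s' => ((Loaded D s' ∧ s'.nat 13 0 0 = J ∧ s'.nat 19 = s.nat 19 ∧ s'.nat 20 = s.nat 20) ∧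
      ((∀ j ≠ J, s'.real 2 j = s.real 2 j) ∧ ∀ j ≠ J, s'.real 3 j = s.real 3 j)) ∧
      ((s'.nat 15 0 0 = 0 ∧ (∑ q ∈ Finset.range D.d, s'.real 2 J q ^ 2 = 1 ∧
        D.Useful (fun i => s.nat 20 i 0) (D.rowValue s' J)) ∧
        s'.nat 18 0 0 = D.covered (D.rowValue s' J) (fun i => s.nat 20 i 0) D.n) ∨
        (s'.nat 15 0 0 ≠ 0 ∧ s'.nat 6 0 0 ≤ N)))
    (fun s' => if s'.nat 15 0 0 = 0 then 0 else N + 1 - s'.nat 6 0 0)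
    (T := 6 + (D.buildTime (D.n ^ D.len) +
      (8 + (D.n * (38 * D.d + 20 + 60 + 16) + 12 + 30) + 8)))
    ?_ (s := (setN 6 (.const 0) ⨟ setN 15 (.const 1)).effect s) ?_ (B := D.n ^ D.len) ?_
    (k := 6) rfl
  · refine (Run.straight_seq rfl key).mono ?_ ?_
    · have e : (setN 6 (.const 0) ⨟ setN 15 (.const 1)).cost = 8 := rfl
      rw [e, Inst.findTime]
      omega
    · rintro s' - ⟨⟨⟨-, h⟩, h'⟩, hlt⟩
      simp only [Test.Holds, NatExpr.eval, nv_eval] at hlt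
      rcases h' with ⟨-, h₁, h₂⟩ | h'
      · exact ⟨h₁, h, h₂⟩
      · omega
  · rintro s' ⟨⟨⟨hs', h13, h19, h20⟩, k₂, k₃⟩, h⟩ hlt
    simp only [Test.Holds, NatExpr.eval, nv_eval] at hlt
    obtain ⟨-, hle⟩ := h.resolve_left (by omega)
    have hmono : D.buildTime (s'.nat 6 0 0) ≤ D.buildTime (D.n ^ D.len) :=
      Nat.mul_le_mul_left _ (by omega)
    have hs₁ : Loaded D ((setN 7 (nv 6)).effect s') :=
      hs'.frame (Frame.effect rfl s') (by decide) (by decide)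
    refine (Run.straight_seq (T := D.buildTime (D.n ^ D.len) +
      (8 + (D.n * (38 * D.d + 20 + 60 + 16) + 12 + 30) + 8)) rfl
      (((buildRow_run (J := J) (m := s'.nat 6 0 0) hs₁ ?_ ?_).time hmono).seq
        fun s₂ f₂ ⟨hc, ⟨g₂, g₃⟩, _⟩ => ?_)).time le_rfl
    · simpa using h13
    · simp
    have hs₂ := hs₁.frame f₂ (by decide) (by decide)
    have e13 : s₂.nat 13 0 0 = J := by rw [f₂.nat 13 (by decide)]; simpa using h13
    have e19 : s₂.nat 19 = s.nat 19 := by rw [f₂.nat 19 (by decide)]; simpa using h19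
    have e20 : s₂.nat 20 = s.nat 20 := by rw [f₂.nat 20 (by decide)]; simpa using h20
    have e6 : s₂.nat 6 = s'.nat 6 := by rw [f₂.nat 6 (by decide)]; simp
    refine (checkRow_run hs₂ e13 (by rw [e19, e20, hR])).seq fun s₃ f₃ ⟨h₃, h₃'⟩ =>
      (Run.straight rfl ?_).time (by decide)
    have hs₃ := hs₂.frame f₃ (by decide) (by decide)
    have hs₄ : Loaded D ((setN 6 (.add (nv 6) (.const 1))).effect s₃) :=
      hs₃.frame (Frame.effect rfl s₃) (by decide) (by decide)
    have r2 : s₃.real 2 = s₂.real 2 := f₃.real 2 (by decide)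
    have r3 : s₃.real 3 = s₂.real 3 := f₃.real 3 (by decide)
    have e6' : s₃.nat 6 = s'.nat 6 := by rw [f₃.nat 6 (by decide), e6]
    have hrv : D.rowValue ((setN 6 (.add (nv 6) (.const 1))).effect s₃) J = D.rowValue s₂ J := by
      funext i
      simp [Inst.rowValue, r2, r3]
    rw [e20] at h₃ h₃'
    refine ⟨⟨⟨⟨hs₄, ?_, ?_, ?_⟩, fun j hj => ?_, fun j hj => ?_⟩, ?_⟩, ?_⟩
    · simp [f₃.nat 13 (by decide), e13]
    · simp [f₃.nat 19 (by decide), e19]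
    · simp [f₃.nat 20 (by decide), e20]
    · simp [r2, g₂ j hj, k₂ j hj]
    · simp [r3, g₃ j hj, k₃ j hj]
    · rw [hrv]
      by_cases hz : s₃.nat 15 0 0 = 0
      · refine Or.inl ⟨by simp [hz], ⟨?_, h₃.1 hz⟩, by simpa using h₃'⟩
        have := Inst.HoldsCand.sum_sq hc
        simpa [r2] using this
      · refine Or.inr ⟨by simp [hz], ?_⟩
        -- The code `N` itself would have passed the check.
        have hne : s'.nat 6 0 0 ≠ N := by
          intro he
          refine hz (h₃.2 ?_)
          have : D.rowValue s₂ J = D.candValue f := by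
            funext i
            rw [Inst.HoldsCand.rowValue hc, he, D.candValue_congr hNd]
          rwa [this]
        simp [NatExpr.eval, e6']
        omega
    · simp [NatExpr.eval, e6']
      split_ifs <;> omega
  · refine ⟨⟨⟨hs₀, ?_, ?_, ?_⟩, ?_⟩, Or.inr ?_⟩ <;> simp [Prog.effect, NatExpr.eval, hJ]
  · simpa [Prog.effect, NatExpr.eval] using hN

/-- Remove the marks of the points that row `13` excludes, and count the row as chosen. -/
def markRow : Prog :=
  forTo 14 0 (evalRow ⨟
    .cond (.realLt (rv 6) (.sub (.const 0) quarter))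
      (.setNat 20 (nv 14) (.const 0) (.const 0)) .skip) ⨟
  setN 19 (.sub (nv 19) (nv 18)) ⨟ setN 4 (.add (nv 4) (.const 1))

theorem markRow_run {D : Inst} {s : Store} (hs : Loaded D s) {J : ℕ} (hJ : s.nat 13 0 0 = J) :
    Run markRow s (D.n * (38 * D.d + 20 + 25 + 16) + 12 + 20) fun s' =>
      (∀ i, s'.nat 20 i 0 =
        if i < D.n ∧ D.rowValue s J i < -(D.γ / 4) then 0 else s.nat 20 i 0) ∧
      s'.nat 19 0 0 = s.nat 19 0 0 - s.nat 18 0 0 ∧ s'.nat 4 0 0 = s.nat 4 0 0 + 1 := by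
  refine (Run.forTo (B := D.n) (T := 38 * D.d + 20 + 25)
    (fun k s' => ∀ i, s'.nat 20 i 0 =
        if i < k ∧ D.rowValue s J i < -(D.γ / 4) then 0 else s.nat 20 i 0)
    hs.n (by decide) (by decide) (by decide) ?_ ?_ ?_).seq fun s' hf h =>
      (Run.straight rfl ⟨fun i => ?_, ?_, ?_⟩).time (by decide)
  · intro i s' x h; simpa using h
  · simp
  · rintro k s' hk hf h14 h
    have hs' := hs.frame hf (by decide) (by decide)
    have e13 : s'.nat 13 0 0 = J := by rw [hf.nat 13 (by decide), hJ]
    refine (evalRow_run hs' e13 h14).seq fun s₁ f₁ h₁ =>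
      (Run.straight rfl fun i => ?_).time (by decide)
    have hs₁ := hs'.frame f₁ (by decide) (by decide)
    have e14 : s₁.nat 14 0 0 = k := by rw [f₁.nat 14 (by decide), h14]
    have e20 : s₁.nat 20 = s'.nat 20 := f₁.nat 20 (by decide)
    have hv : s₁.real 6 0 0 = D.rowValue s J k := by
      rw [h₁, Inst.rowValue, Inst.rowValue, hf.real 2 (by decide), hf.real 3 (by decide)]
    have hlt : i < k + 1 ↔ i < k ∨ i = k := Nat.lt_succ_iff_lt_or_eq
    by_cases hc : D.rowValue s J k < -(D.γ / 4)
    · by_cases hik : i = k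
      · subst hik
        simp [Prog.effect, Test.Holds, RealExpr.eval, NatExpr.eval, quarter, hs₁.γ, hv, hc, e14]
      · simp [Prog.effect, Test.Holds, RealExpr.eval, NatExpr.eval, quarter, hs₁.γ, hv, hc, e14,
          hik, e20, h, hlt]
    · by_cases hik : i = k
      · subst hik
        simp [Prog.effect, Test.Holds, RealExpr.eval, quarter, hs₁.γ, hv, hc, e20, h]
      · simp [Prog.effect, Test.Holds, RealExpr.eval, quarter, hs₁.γ, hv, hc, hik, e20, h, hlt]
  · simpa [Prog.effect] using h i
  · simp [Prog.effect, NatExpr.eval, hf.nat 19 (by decide), hf.nat 18 (by decide)]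
  · simp [Prog.effect, NatExpr.eval, hf.nat 4 (by decide)]

/-- Mark the negative points in table `20` and count them in variable `19`. -/
def initMarks : Prog :=
  forTo 14 0 (.setNat 20 (nv 14) (.const 0) (.sub (.const 1) labelCell) ⨟
    setN 19 (.add (nv 19) (.sub (.const 1) labelCell)))

theorem initMarks_run {D : Inst} {s : Store} (hs : Loaded D s) (h19 : s.nat 19 0 0 = 0) :
    Run initMarks s (D.n * (40 + 16) + 12) fun s' =>
      (∀ i < D.n, s'.nat 20 i 0 = 1 - D.y i) ∧
      s'.nat 19 0 0 = ∑ i ∈ Finset.range D.n, (1 - D.y i) := by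
  refine Run.forTo (B := D.n) (T := 40)
    (fun k s' => (∀ i < k, s'.nat 20 i 0 = 1 - D.y i) ∧
      s'.nat 19 0 0 = ∑ i ∈ Finset.range k, (1 - D.y i))
    hs.n (by decide) (by decide) (by decide) ?_ ?_ ?_
  · intro i s' x h; simpa using h
  · simp [h19]
  · rintro k s' hk hf h14 ⟨h, h'⟩
    have hs' := hs.frame hf (by decide) (by decide)
    refine (Run.straight rfl ⟨fun i hi => ?_, ?_⟩).time (by decide)
    · by_cases hik : i = k
      · simp [Prog.effect, NatExpr.eval, labelCell, h14, hs'.y, hik]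
      · simpa [Prog.effect, NatExpr.eval, labelCell, h14, hs'.y, hik] using h i (by omega)
    · simp [Prog.effect, NatExpr.eval, labelCell, h14, hs'.y, h', Finset.sum_range_succ]

/-- Choose useful halfspaces one after another, at least one of them, until no negative point
is marked any more. -/
def greedyCover : Prog :=
  computeK ⨟ initMarks ⨟
  .loop (.neg (.both (.natLt (nv 19) (.const 1)) (.natLt (.const 0) (nv 4))))
    (setN 13 (nv 4) ⨟ findRow ⨟ markRow)

/-- The loop invariant of the greedy algorithm. The marked points are the negative points that no
row chosen so far excludes. Their number drops by the factor `1 - 1 / t ≤ exp (-1 / t)` with each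
row; it is at least one before each row but the first is chosen, which bounds the number of
rows. -/
structure GreedyInv (D : Inst) (s : Store) : Prop where
  loaded : Loaded D s
  unit : ∀ j < s.nat 4 0 0, ∑ q ∈ Finset.range D.d, s.real 2 j q ^ 2 = 1
  pos : ∀ j < s.nat 4 0 0, ∀ i < D.n, 0 < D.y i → D.γ / 4 < D.rowValue s j i
  mark_pos : ∀ i < D.n, 0 < D.y i → s.nat 20 i 0 = 0
  mark_neg : ∀ i < D.n, D.y i = 0 → s.nat 20 i 0 = 0 →
    ∃ j < s.nat 4 0 0, D.rowValue s j i < -(D.γ / 4)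
  count : s.nat 19 0 0 = ∑ i ∈ Finset.range D.n, s.nat 20 i 0
  decay : (s.nat 19 0 0 : ℝ) ≤ D.n * Real.exp (-(s.nat 4 0 0 / D.t))
  rows : (s.nat 4 0 0 : ℝ) ≤ D.t * Real.log D.n + 1

theorem greedy_round {D : Inst} (hD : D.Coverable) (ht : 0 < D.t) {s : Store}
    (h : GreedyInv D s) (hcont : s.nat 19 0 0 < 1 → ¬ 0 < s.nat 4 0 0) :
    Run (setN 13 (nv 4) ⨟ findRow ⨟ markRow) s
      (6 + (D.findTime + (D.n * (38 * D.d + 20 + 25 + 16) + 12 + 20))) fun s' =>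
      GreedyInv D s' ∧ s'.nat 19 0 0 + (1 - s'.nat 4 0 0) < s.nat 19 0 0 + (1 - s.nat 4 0 0) := by
  have hs₀ : Loaded D ((setN 13 (nv 4)).effect s) :=
    h.loaded.frame (Frame.effect rfl s) (by decide) (by decide)
  set r := s.nat 4 0 0 with hr
  have ht' : (0 : ℝ) < D.t := by exact_mod_cast ht
  refine Run.straight_seq rfl ((findRow_run hD ht hs₀ (J := r) (by simp [hr])
    (by simpa using h.count) (by simpa using h.mark_pos)).seq
    fun s₁ f₁ ⟨⟨hunit, huse⟩, ⟨k₂, k₃⟩, h18⟩ => ?_)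
  have hs₁ := hs₀.frame f₁ (by decide) (by decide)
  have e13 : s₁.nat 13 0 0 = r := by rw [f₁.nat 13 (by decide)]; simp [hr]
  have e4 : s₁.nat 4 0 0 = r := by rw [f₁.nat 4 (by decide)]; simp [hr]
  have e19 : s₁.nat 19 = s.nat 19 := by rw [f₁.nat 19 (by decide)]; simp
  have e20 : s₁.nat 20 = s.nat 20 := by rw [f₁.nat 20 (by decide)]; simp
  simp only [setN_effect, Store.writeNat_real] at k₂ k₃
  simp only [setN_effect, Store.writeNat_nat_of_ne _ _ _ _ _ (show 20 ≠ 13 by decide)] at huse h18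
  refine (markRow_run hs₁ e13).mono le_rfl fun s₂ f₂ ⟨m20, m19, m4⟩ => ?_
  rw [e19, h18] at m19
  rw [e4] at m4
  rw [e20] at m20
  have r2 : s₂.real 2 = s₁.real 2 := f₂.real 2 (by decide)
  have r3 : s₂.real 3 = s₁.real 3 := f₂.real 3 (by decide)
  have hrv : ∀ j, D.rowValue s₂ j = D.rowValue s₁ j := fun j => by
    funext i; simp only [Inst.rowValue, r2, r3]
  have hrv' : ∀ j < r, D.rowValue s₁ j = D.rowValue s j := fun j hj => by
    funext i; simp only [Inst.rowValue, k₂ j hj.ne, k₃ j hj.ne]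
  obtain ⟨hpos, hcov⟩ := huse
  set cnt := D.covered (D.rowValue s₁ r) (fun i => s.nat 20 i 0) D.n with hcnt
  have hsum : s.nat 19 0 0 = ∑ i ∈ Finset.range D.n, s₂.nat 20 i 0 + cnt := by
    rw [h.count, hcnt, Inst.covered, ← Finset.sum_add_distrib]
    refine Finset.sum_congr rfl fun i hi => ?_
    rw [m20]
    by_cases hc : D.rowValue s₁ r i < -(D.γ / 4)
    · simp [hc, Finset.mem_range.1 hi]
    · simp [hc]
  rw [← h.count] at hcov
  have hle : cnt ≤ s.nat 19 0 0 := by omega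
  refine ⟨⟨hs₁.frame f₂ (by decide) (by decide), fun j hj => ?_, fun j hj => ?_, fun i hi hy => ?_,
    fun i hi hy hz => ?_, ?_, ?_, ?_⟩, ?_⟩
  · rw [r2]
    rcases (Nat.lt_succ_iff.1 (m4 ▸ hj)).lt_or_eq with hj | rfl
    · rw [k₂ j hj.ne]; exact h.unit j hj
    · exact hunit
  · rw [hrv]
    rcases (Nat.lt_succ_iff.1 (m4 ▸ hj)).lt_or_eq with hj | rfl
    · rw [hrv' j hj]; exact h.pos j hj
    · exact hpos
  · rw [m20, h.mark_pos i hi hy, ite_self]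
  · rw [m4]
    rw [m20] at hz
    split_ifs at hz with hc
    · exact ⟨r, by omega, by rw [hrv]; exact hc.2⟩
    · obtain ⟨j, hj, hv⟩ := h.mark_neg i hi hy hz
      exact ⟨j, by omega, by rwa [hrv, hrv' j hj]⟩
  · omega
  · rw [m19, m4, Nat.cast_sub hle]
    have h1 : (s.nat 19 0 0 : ℝ) / D.t ≤ cnt := by
      rw [div_le_iff₀ ht']
      exact_mod_cast hcov
    have h2 := Real.add_one_le_exp (-(1 / (D.t : ℝ)))
    calc (s.nat 19 0 0 : ℝ) - cnt ≤ s.nat 19 0 0 * (-(1 / (D.t : ℝ)) + 1) := by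
          have : (s.nat 19 0 0 : ℝ) * (-(1 / (D.t : ℝ)) + 1) =
            s.nat 19 0 0 - s.nat 19 0 0 / D.t := by ring
          linarith
      _ ≤ s.nat 19 0 0 * Real.exp (-(1 / (D.t : ℝ))) := by gcongr
      _ ≤ D.n * Real.exp (-(r / D.t)) * Real.exp (-(1 / (D.t : ℝ))) := by
          gcongr
          exact h.decay
      _ = D.n * Real.exp (-(((r + 1 : ℕ) : ℝ) / D.t)) := by
          rw [mul_assoc, ← Real.exp_add]
          congr 2
          push_cast
          ring
  · rw [m4]
    push_cast
    have hn : (1 : ℝ) ≤ D.n := by exact_mod_cast D.n_pos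
    rcases Nat.eq_zero_or_pos r with h0 | h0
    · rw [h0]
      have := mul_nonneg ht'.le (Real.log_nonneg hn)
      simpa using this
    · have hR : 1 ≤ s.nat 19 0 0 := by
        by_contra hlt
        exact hcont (by omega) h0
      have h1 : (1 : ℝ) ≤ D.n * Real.exp (-(r / D.t)) :=
        le_trans (by exact_mod_cast hR) h.decay
      have h2 := Real.log_le_log one_pos h1
      rw [Real.log_mul (by positivity) (by positivity), Real.log_exp, Real.log_one] at h2
      have h3 : (r : ℝ) / D.t ≤ Real.log D.n := by linarith
      rw [div_le_iff₀ ht'] at h3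
      linarith
  · rcases Nat.eq_zero_or_pos (s.nat 19 0 0) with h0 | h0
    · have := hcont (by omega)
      omega
    · have : 0 < cnt := by
        by_contra hc
        rw [Nat.eq_zero_of_not_pos hc, zero_mul] at hcov
        omega
      omega

theorem greedyCover_loop {D : Inst} (hD : D.Coverable) (ht : 0 < D.t) {s : Store}
    (h : GreedyInv D s) :
    Run (.loop (.neg (.both (.natLt (nv 19) (.const 1)) (.natLt (.const 0) (nv 4))))
        (setN 13 (nv 4) ⨟ findRow ⨟ markRow)) s
      ((s.nat 19 0 0 + 1) *
        (6 + (D.findTime + (D.n * (38 * D.d + 20 + 25 + 16) + 12 + 20)) + 13) + 13)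
      fun s' => ∃ r : ℕ, (r : ℝ) ≤ D.t * Real.log D.n + 1 ∧ 0 < r ∧ D.Solved r s' := by
  refine (Run.loop (GreedyInv D) (fun s' => s'.nat 19 0 0 + (1 - s'.nat 4 0 0))
    (T := 6 + (D.findTime + (D.n * (38 * D.d + 20 + 25 + 16) + 12 + 20)))
    (fun s' h' hc => greedy_round hD ht h' ?_) h (B := s.nat 19 0 0 + 1) (by omega)
    (k := 13) rfl).mono le_rfl ?_
  · simpa [Test.Holds, NatExpr.eval] using hc
  · rintro s' - ⟨h', hc⟩
    simp only [Test.Holds, NatExpr.eval, nv_eval, not_not] at hc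
    refine ⟨_, h'.rows, hc.2, rfl, h'.unit, fun i hi => ?_⟩
    rw [Inst.Ok]
    split_ifs with hy
    · exact fun j hj => h'.pos j hj i hi hy
    · refine h'.mark_neg i hi (by omega) ?_
      have := h'.count
      rw [Nat.lt_one_iff.1 hc.1] at this
      exact Finset.sum_eq_zero_iff.1 this.symm i (Finset.mem_range.2 hi)

/-! ### Good candidates exist -/

namespace Inst

variable (D : Inst)

/-- Point `i` as a vector. -/
noncomputable def pt (i : ℕ) : EuclideanSpace ℝ (Fin D.d) := WithLp.toLp 2 fun q => D.x i q

theorem sum_range_eq_inner {d : ℕ} (u v : ℕ → ℝ) :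
    ∑ q ∈ Finset.range d, u q * v q =
      inner ℝ (WithLp.toLp 2 fun q : Fin d => u q : EuclideanSpace ℝ (Fin d))
        (WithLp.toLp 2 fun q : Fin d => v q) := by
  rw [Finset.sum_range, PiLp.inner_apply]
  exact Finset.sum_congr rfl fun q _ => by simp [mul_comm]

theorem sum_sub_pt (f : ℕ → ℕ) (K : ℕ) :
    ∑ l ∈ Finset.range K, (D.pt (f (2 * l)) - D.pt (f (2 * l + 1))) =
      WithLp.toLp 2 fun q : Fin D.d => D.diffSum f K q := by
  ext q
  simp [pt, diffSum]

theorem sqNorm_eq (f : ℕ → ℕ) :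
    D.sqNorm f = ‖∑ l ∈ Finset.range D.K, (D.pt (f (2 * l)) - D.pt (f (2 * l + 1)))‖ ^ 2 := by
  rw [sum_sub_pt, ← real_inner_self_eq_norm_sq, ← sum_range_eq_inner, sqNorm]
  simp only [sq]

theorem candValue_eq {f : ℕ → ℕ} {w : EuclideanSpace ℝ (Fin D.d)}
    (hw : w = ∑ l ∈ Finset.range D.K, (D.pt (f (2 * l)) - D.pt (f (2 * l + 1)))) (h0 : 0 < ‖w‖)
    (i : ℕ) :
    D.candValue f i = (inner ℝ w (D.pt i) - (inner ℝ w (D.pt (f (2 * D.K))) +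
      inner ℝ w (D.pt (f (2 * D.K + 1)))) / 2) / ‖w‖ := by
  have hs : D.sqNorm f = ‖w‖ ^ 2 := by rw [hw, sqNorm_eq]
  have hpos : 0 < D.sqNorm f := by rw [hs]; positivity
  have hN : ∀ q, D.candNormal f q = D.diffSum f D.K q / ‖w‖ := fun q => by
    rw [candNormal, if_pos hpos, hs, Real.sqrt_sq h0.le]
  have hin : ∀ a, ∑ q ∈ Finset.range D.d, D.candNormal f q * D.x a q =
      inner ℝ w (D.pt a) / ‖w‖ := fun a => by
    rw [hw, sum_sub_pt, pt, ← sum_range_eq_inner, ← sum_sub_pt, ← hw, Finset.sum_div]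
    exact Finset.sum_congr rfl fun q _ => by rw [hN]; ring
  rw [candValue, candOffset, if_pos hpos, hin]
  have : ∀ a b, ∑ q ∈ Finset.range D.d, -(D.candNormal f q * (D.x a q + D.x b q) / 2) =
      -(inner ℝ w (D.pt a) / ‖w‖ + inner ℝ w (D.pt b) / ‖w‖) / 2 := fun a b => by
    rw [← hin, ← hin, ← Finset.sum_add_distrib, ← Finset.sum_neg_distrib, Finset.sum_div]
    exact Finset.sum_congr rfl fun q _ => by ring
  rw [this]
  ring

/-- If the list of indices is constant then the differences vanish, so that the candidate
halfspace is trivial. -/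
theorem candValue_const (a i : ℕ) :
    D.candValue (fun _ => a) i = 4 * D.y a - 2 + D.x i 0 := by
  have h0 : D.sqNorm (fun _ => a) = 0 := by simp [sqNorm, diffSum]
  rw [candValue, candOffset]
  simp [candNormal, h0, D.d_pos]

theorem abs_x_le {i : ℕ} (hi : ‖D.pt i‖ ≤ 1) : |D.x i 0| ≤ 1 := by
  have := (PiLp.norm_apply_le (D.pt i) ⟨0, D.d_pos⟩).trans hi
  simpa [pt] using this

/-- Each halfspace with margin `γ` can be replaced by a candidate halfspace with margin
`γ / 4`. -/
theorem exists_candidate (hγ : 0 < D.γ) (hγ1 : D.γ ≤ 1) (hx : ∀ i < D.n, ‖D.pt i‖ ≤ 1)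
    (hK : 3 / D.γ ^ 2 ≤ D.K) {w₀ : EuclideanSpace ℝ (Fin D.d)} (hw₀ : ‖w₀‖ = 1) {b : ℝ}
    (hpos : ∀ i < D.n, 0 < D.y i → D.γ < inner ℝ w₀ (D.pt i) + b) :
    ∃ f : ℕ → ℕ, (∀ k, f k < D.n) ∧ (∀ i < D.n, 0 < D.y i → D.γ / 4 < D.candValue f i) ∧
      ∀ i < D.n, inner ℝ w₀ (D.pt i) + b < -D.γ → D.candValue f i < -(D.γ / 4) := by
  have hQ0 : ∀ i < D.n, inner ℝ w₀ (D.pt i) + b < -D.γ → D.y i = 0 := fun i hi h => by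
    by_contra hy
    have := hpos i hi (Nat.pos_of_ne_zero hy)
    linarith
  by_cases hP : ∃ p < D.n, 0 < D.y p
  swap
  -- There are no positive points: exclude the whole ball.
  · push Not at hP
    refine ⟨fun _ => 0, fun _ => D.n_pos, fun i hi hy => absurd hy (by have := hP i hi; omega),
      fun i hi _ => ?_⟩
    rw [candValue_const, Nat.le_zero.1 (hP 0 D.n_pos)]
    have := abs_le.1 (D.abs_x_le (hx i hi))
    push_cast
    linarith
  obtain ⟨p₀, hp₀, hyp₀⟩ := hP
  by_cases hQ : ∃ q < D.n, inner ℝ w₀ (D.pt q) + b < -D.γ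
  swap
  -- The halfspace excludes no points beyond the margin: include the whole ball.
  · push Not at hQ
    refine ⟨fun _ => p₀, fun _ => hp₀, fun i hi _ => ?_,
      fun i hi h => absurd h (not_lt.2 (hQ i hi))⟩
    rw [candValue_const]
    have := abs_le.1 (D.abs_x_le (hx i hi))
    have hy : (1 : ℝ) ≤ D.y p₀ := by exact_mod_cast hyp₀
    linarith
  obtain ⟨q₀, hq₀, hwq₀⟩ := hQ
  obtain ⟨g, g', hg⟩ := exists_sum_sub_separating (x := fun i : Fin D.n => D.pt i)
    (P := fun i => 0 < D.y i) (Q := fun i => inner ℝ w₀ (D.pt i) + b < -D.γ)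
    (fun i => hx i i.2) ⟨p₀, hp₀⟩ hw₀ hγ (fun i hi => hpos i i.2 hi) (fun i hi => hi) hK
  set w := ∑ k ∈ Finset.range D.K, (D.pt (g k) - D.pt (g' k)) with hw
  have h0 : 0 < ‖w‖ := by
    rw [norm_pos_iff]
    intro hw0
    have := hg ⟨p₀, hp₀⟩ ⟨q₀, hq₀⟩ hyp₀ hwq₀
    simp only [hw0] at this
    simp at this
  obtain ⟨a, ha, hamin⟩ := Finset.exists_min_image
    ((Finset.range D.n).filter fun i => 0 < D.y i) (fun i => inner ℝ w (D.pt i))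
    ⟨p₀, by simp [hp₀, hyp₀]⟩
  have hex := Finset.exists_max_image (Finset.univ.filter fun i : Fin D.n =>
    inner ℝ w₀ (D.pt i) + b < -D.γ) (fun i => inner ℝ w (D.pt i))
    ⟨⟨q₀, hq₀⟩, by simpa using hwq₀⟩
  obtain ⟨c, hc, hcmax⟩ := hex
  simp only [Finset.mem_filter, Finset.mem_range, Finset.mem_univ, true_and] at ha hamin hc hcmax
  have hgap := hg ⟨a, ha.1⟩ c ha.2 hc
  rw [inner_sub_right] at hgap
  refine ⟨fun k => if k = 2 * D.K then a else if k = 2 * D.K + 1 then c else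
    if k % 2 = 0 then g (k / 2) else g' (k / 2), fun k => ?_, ?_⟩
  · dsimp only
    split_ifs
    exacts [ha.1, c.2, (g _).2, (g' _).2]
  have hval := fun i => D.candValue_eq (f := fun k => if k = 2 * D.K then a else
    if k = 2 * D.K + 1 then c else if k % 2 = 0 then g (k / 2) else g' (k / 2)) (w := w) ?_ h0 i
  swap
  · rw [hw]
    refine Finset.sum_congr rfl fun l hl => ?_
    have hl := Finset.mem_range.1 hl
    have e1 : (2 * l + 1) / 2 = l := by omega
    simp only [show 2 * l ≠ 2 * D.K by omega, show 2 * l ≠ 2 * D.K + 1 by omega,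
      show 2 * l + 1 ≠ 2 * D.K by omega, show 2 * l + 1 ≠ 2 * D.K + 1 by omega, if_false,
      show 2 * l % 2 = 0 by omega, show (2 * l + 1) % 2 ≠ 0 by omega, if_true, e1,
      show 2 * l / 2 = l by omega]
  simp only [if_true, show 2 * D.K + 1 ≠ 2 * D.K by omega, if_false] at hval
  refine ⟨fun i hi hy => ?_, fun i hi h => ?_⟩
  · rw [hval, lt_div_iff₀ h0]
    have := hamin i ⟨hi, hy⟩
    dsimp only at this hgap
    linarith
  · rw [hval, div_lt_iff₀ h0]
    have := hcmax ⟨i, hi⟩ h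
    dsimp only at this hgap
    linarith

end Inst

/-! ### The instance given as input -/

section Input

variable {n d t : ℕ} {γ : ℝ} {X : Fin n → EuclideanSpace ℝ (Fin d)} {y : Fin n → Bool}

/-- The instance that the input describes. -/
noncomputable def inst (t : ℕ) (γ : ℝ) (X : Fin n → EuclideanSpace ℝ (Fin d)) (y : Fin n → Bool)
    (hn : 0 < n) (hd : 0 < d) : Inst where
  n := n
  d := d
  t := t
  K := ⌈3 / γ ^ 2⌉₊
  γ := γ
  x := (input t γ X y).real 1
  y i := (input t γ X y).nat 3 i 0
  n_pos := hn
  d_pos := hd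

variable {hn : 0 < n} {hd : 0 < d}

theorem loaded_inst {p : Prog} {s : Store} (hf : Frame p (input t γ X y) s)
    (hp : ∀ a ∈ [0, 1, 2, 3], a ∉ p.natTables) (hr : ∀ a ∈ [0, 1], a ∉ p.realTables)
    (hK : s.nat 5 0 0 = ⌈3 / γ ^ 2⌉₊) : Loaded (inst t γ X y hn hd) s where
  n := by rw [hf.nat 0 (hp 0 (by decide))]; rfl
  d := by rw [hf.nat 1 (hp 1 (by decide))]; rfl
  t := by rw [hf.nat 2 (hp 2 (by decide))]; rfl
  y i := by rw [hf.nat 3 (hp 3 (by decide))]; rfl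
  K := hK
  γ := by rw [hf.real 0 (hr 0 (by decide))]; rfl
  x := by rw [hf.real 1 (hr 1 (by decide))]; rfl

theorem inst_pt (i : Fin n) : (inst t γ X y hn hd).pt i = X i := by
  ext q
  simp [Inst.pt, inst, input]

theorem inst_y (i : Fin n) : (inst t γ X y hn hd).y i = (y i).toNat := by
  simp [inst, input]

theorem inst_coverable (hγ : 0 < γ) (hγ1 : γ ≤ 1) (hX : ∀ i, ‖X i‖ ≤ 1) {P : TPolytope d t}
    (hP : P.Consistent γ X y) : (inst t γ X y hn hd).Coverable := by
  have ht := hP.pos hγ hn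
  have hcor := fun i => (P.correct_iff (x := X i) hγ ht (y i)).1 (hP i)
  have hx : ∀ i < n, ‖(inst t γ X y hn hd).pt i‖ ≤ 1 := fun i hi => by
    rw [show i = (⟨i, hi⟩ : Fin n) from rfl, inst_pt]
    exact hX _
  have hcand := fun j : Fin t => (inst t γ X y hn hd).exists_candidate hγ hγ1 hx
    (Nat.le_ceil _) (P.norm_w j) (b := P.b j) (fun i hi hy => by
      rw [show i = (⟨i, hi⟩ : Fin n) from rfl, inst_y] at hy
      have h := hcor ⟨i, hi⟩
      rw [if_pos (by cases hb : y ⟨i, hi⟩ <;> simp_all)] at h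
      rw [show i = (⟨i, hi⟩ : Fin n) from rfl, inst_pt]
      exact h j)
  choose f hf hpos hneg using hcand
  refine ⟨fun j => if h : j < t then f ⟨j, h⟩ else fun _ => 0, fun j k => ?_, fun i hi => ?_⟩
  · dsimp only
    split_ifs with h
    · exact hf _ k
    · exact hn
  · rw [Inst.Ok]
    split_ifs with hy
    · intro j hj
      have hj : j < t := hj
      simp only [hj, dif_pos]
      exact hpos ⟨j, hj⟩ i hi hy
    · have h := hcor ⟨i, hi⟩
      rw [show i = (⟨i, hi⟩ : Fin n) from rfl, inst_y] at hy
      rw [if_neg (by simpa using hy)] at h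
      obtain ⟨j, hj⟩ := h
      refine ⟨j, j.2, ?_⟩
      simp only [j.2, dif_pos]
      refine hneg j i hi ?_
      rw [show i = (⟨i, hi⟩ : Fin n) from rfl, inst_pt]
      exact hj

theorem exists_output {r : ℕ} (hr : 0 < r) (hγ : 0 < γ) {s : Store}
    (h : (inst t γ X y hn hd).Solved r s) :
    ∃ Q : TPolytope d r, Outputs s Q ∧ Q.Consistent (γ / 4) X y := by
  obtain ⟨h4, hunit, hok⟩ := h
  let Q : TPolytope d r :=
    { w := fun j => WithLp.toLp 2 fun q => s.real 2 j q
      b := fun j => s.real 3 j 0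
      norm_w := fun j => by
        have : ∑ q ∈ Finset.range d, s.real 2 j q ^ 2 = 1 := hunit j j.2
        rw [Finset.sum_range] at this
        rw [EuclideanSpace.norm_eq, Real.sqrt_eq_one]
        simpa using this }
  refine ⟨Q, ⟨h4, fun _ _ => rfl, fun _ => rfl⟩, fun i => ?_⟩
  have hval : ∀ j : Fin r, (inst t γ X y hn hd).rowValue s j i = inner ℝ (Q.w j) (X i) + Q.b j := by
    intro j
    rw [Inst.rowValue, add_comm, Inst.sum_range_eq_inner, ← inst_pt (t := t) (γ := γ) (y := y)
      (hn := hn) (hd := hd) (X := X) i]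
    rfl
  have := hok i i.2
  rw [Inst.Ok, inst_y] at this
  rw [Q.correct_iff (by positivity) hr]
  cases hy : y i
  · rw [hy] at this
    simp only [Bool.toNat_false, lt_irrefl, if_false] at this
    obtain ⟨j, hj, hv⟩ := this
    rw [if_neg (by simp)]
    exact ⟨⟨j, hj⟩, by rw [← hval]; exact hv⟩
  · rw [hy] at this
    simp only [Bool.toNat_true, zero_lt_one, if_true] at this
    rw [if_pos rfl]
    exact fun j => by rw [← hval]; exact this j j.2

end Input

/-! ### The running time -/

theorem exponent_le {t : ℕ} {γ : ℝ} (hγ : 0 < γ) (hγ1 : γ ≤ 1) :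
    ((20 * (⌈3 / γ ^ 2⌉₊ + 1) * t : ℕ) : ℝ) ≤ 200 * (t * (γ ^ 2)⁻¹ * Real.log (2 / γ)) := by
  have h1 : 1 ≤ (γ ^ 2)⁻¹ := (one_le_inv₀ (by positivity)).2 (pow_le_one₀ hγ.le hγ1)
  have h2 : (⌈3 / γ ^ 2⌉₊ : ℝ) ≤ 3 * (γ ^ 2)⁻¹ + 1 := by
    rw [← div_eq_mul_inv]
    exact (Nat.ceil_lt_add_one (by positivity)).le
  have h3 : 1 / 2 ≤ Real.log (2 / γ) := by
    have : Real.log 2 ≤ Real.log (2 / γ) :=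
      Real.log_le_log (by norm_num) (by rw [le_div_iff₀ hγ]; linarith)
    linarith [Real.log_two_gt_d9]
  push_cast
  have ht : (0 : ℝ) ≤ t := t.cast_nonneg
  calc (20 * ((⌈3 / γ ^ 2⌉₊ : ℝ) + 1) * t) ≤ 20 * (5 * (γ ^ 2)⁻¹) * t := by
        gcongr
        linarith
    _ = 200 * (t * (γ ^ 2)⁻¹ * (1 / 2)) := by ring
    _ ≤ 200 * (t * (γ ^ 2)⁻¹ * Real.log (2 / γ)) := by gcongr

theorem time_le {n d T E : ℕ} (hn : 2 ≤ n) {B e : ℝ} (hT : T ≤ d * n ^ E) (hE : (E : ℝ) ≤ e)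
    (hB : B = e) : (T : ℝ) ≤ d * (n : ℝ) ^ B := by
  have h1 : (1 : ℝ) ≤ n := by exact_mod_cast (by omega : 1 ≤ n)
  calc (T : ℝ) ≤ d * (n : ℝ) ^ (E : ℝ) := by
        rw [Real.rpow_natCast]
        exact_mod_cast hT
    _ ≤ d * (n : ℝ) ^ B := by
        rw [hB]
        gcongr

theorem exhaustive_time {n d t K A : ℕ} (hn : 2 ≤ n) (hd : 0 < d) (ht : 0 < t)
    (hA : A = n ^ ((2 * K + 2) * t)) :
    23 * K + 15 + (10 + (A * ((t * (600 * (K + 1) * (A + d) + 16) + 18) +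
      ((n * ((t * ((38 * d + 20 + 40) + 16) + 36) + 16) + 16) + 8) + 6) + 6)) ≤
      d * n ^ (20 * (K + 1) * t) := by
  have hA0 : 0 < A := by rw [hA]; positivity
  set M := n * t * (K + 1) * d * A with hM
  have hM0 : 0 < M := by positivity
  have a1 : (K + 1) * A * t ≤ M := Nat.le_of_dvd hM0 ⟨n * d, by rw [hM]; ring⟩
  have a2 : (K + 1) * d * t ≤ M := Nat.le_of_dvd hM0 ⟨n * A, by rw [hM]; ring⟩
  have a3 : n * t * d ≤ M := Nat.le_of_dvd hM0 ⟨(K + 1) * A, by rw [hM]; ring⟩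
  have a4 : n * t ≤ M := Nat.le_of_dvd hM0 ⟨(K + 1) * d * A, by rw [hM]; ring⟩
  have a5 : n ≤ M := Nat.le_of_dvd hM0 ⟨t * (K + 1) * d * A, by rw [hM]; ring⟩
  have a6 : t ≤ M := Nat.le_of_dvd hM0 ⟨n * (K + 1) * d * A, by rw [hM]; ring⟩
  have a7 : K + 1 ≤ M := Nat.le_of_dvd hM0 ⟨n * t * d * A, by rw [hM]; ring⟩
  have hin : (t * (600 * (K + 1) * (A + d) + 16) + 18) +
      ((n * ((t * ((38 * d + 20 + 40) + 16) + 36) + 16) + 16) + 8) + 6 ≤ 2000 * M := by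
    have : (t * (600 * (K + 1) * (A + d) + 16) + 18) +
      ((n * ((t * ((38 * d + 20 + 40) + 16) + 36) + 16) + 16) + 8) + 6 =
      600 * ((K + 1) * A * t) + 600 * ((K + 1) * d * t) + 16 * t + 38 * (n * t * d) +
        76 * (n * t) + 52 * n + 48 := by ring
    rw [this]
    omega
  have hMA : M ≤ A * M := Nat.le_mul_of_pos_left _ hA0
  calc _ ≤ 23 * K + 15 + (10 + (A * (2000 * M) + 6)) := by gcongr
    _ = 23 * K + 31 + 2000 * (A * M) := by ring
    _ ≤ 2 ^ 12 * (A * M) := by omega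
    _ = d * (2 ^ 12 * n * t * (K + 1) * (A * A)) := by rw [hM]; ring
    _ ≤ d * (n ^ 12 * n * n ^ t * n ^ (K + 1) * (A * A)) := by
        have h1 : t ≤ n ^ t := (Nat.lt_pow_self (by omega)).le
        have h2 : K + 1 ≤ n ^ (K + 1) := (Nat.lt_pow_self (by omega)).le
        gcongr
    _ = d * n ^ (13 + t + (K + 1) + 2 * ((2 * K + 2) * t)) := by
        rw [hA]
        ring
    _ ≤ d * n ^ (20 * (K + 1) * t) := by
        gcongr
        · omega
        · nlinarith [Nat.le_mul_of_pos_left t (Nat.succ_pos K),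
            Nat.le_mul_of_pos_right (K + 1) ht]

theorem greedy_time {n d K A : ℕ} (hn : 2 ≤ n) (hd : 0 < d) (hA : A = n ^ (2 * K + 2)) :
    23 * K + 15 + (n * (40 + 16) + 12 + ((n + 1) * (6 + ((14 + A * (6 + (600 * (K + 1) * (A + d) +
      (8 + (n * (38 * d + 20 + 60 + 16) + 12 + 30) + 8)) + 6)) +
      (n * (38 * d + 20 + 25 + 16) + 12 + 20)) + 13) + 13)) ≤
      d * n ^ (20 * (K + 1) * 1) := by
  have hA0 : 0 < A := by rw [hA]; positivity
  set M := n * (K + 1) * d * A with hM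
  have hM0 : 0 < M := by positivity
  have a1 : (K + 1) * A ≤ M := Nat.le_of_dvd hM0 ⟨n * d, by rw [hM]; ring⟩
  have a2 : (K + 1) * d ≤ M := Nat.le_of_dvd hM0 ⟨n * A, by rw [hM]; ring⟩
  have a3 : n * d ≤ M := Nat.le_of_dvd hM0 ⟨(K + 1) * A, by rw [hM]; ring⟩
  have a4 : n ≤ M := Nat.le_of_dvd hM0 ⟨(K + 1) * d * A, by rw [hM]; ring⟩
  have a5 : K + 1 ≤ M := Nat.le_of_dvd hM0 ⟨n * d * A, by rw [hM]; ring⟩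
  have hMA : M ≤ A * M := Nat.le_mul_of_pos_left _ hA0
  have hfind : 6 + (600 * (K + 1) * (A + d) +
      (8 + (n * (38 * d + 20 + 60 + 16) + 12 + 30) + 8)) + 6 ≤ 1500 * M := by
    have : 6 + (600 * (K + 1) * (A + d) +
      (8 + (n * (38 * d + 20 + 60 + 16) + 12 + 30) + 8)) + 6 =
      600 * ((K + 1) * A) + 600 * ((K + 1) * d) + 38 * (n * d) + 96 * n + 70 := by ring
    rw [this]
    omega
  have hround : 6 + ((14 + A * (1500 * M)) + (n * (38 * d + 20 + 25 + 16) + 12 + 20)) + 13 ≤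
      1800 * (A * M) := by
    have : 6 + ((14 + A * (1500 * M)) + (n * (38 * d + 20 + 25 + 16) + 12 + 20)) + 13 =
      1500 * (A * M) + 38 * (n * d) + 61 * n + 65 := by ring
    rw [this]
    omega
  have hnM : A * M ≤ n * (A * M) := Nat.le_mul_of_pos_left _ (by omega)
  calc _ ≤ 23 * K + 15 + (n * (40 + 16) + 12 + ((n + 1) * (6 + ((14 + A * (1500 * M)) +
        (n * (38 * d + 20 + 25 + 16) + 12 + 20)) + 13) + 13)) := by gcongr
    _ ≤ 23 * K + 15 + (n * (40 + 16) + 12 + ((n + n) * (1800 * (A * M)) + 13)) := by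
        gcongr
        omega
    _ = 23 * K + 40 + 56 * n + 3600 * (n * (A * M)) := by ring
    _ ≤ 2 ^ 12 * (n * (A * M)) := by omega
    _ = d * (2 ^ 12 * n ^ 2 * (K + 1) * (A * A)) := by rw [hM]; ring
    _ ≤ d * (n ^ 12 * n ^ 2 * n ^ (K + 1) * (A * A)) := by
        have h2 : K + 1 ≤ n ^ (K + 1) := (Nat.lt_pow_self (by omega)).le
        gcongr
    _ = d * n ^ (14 + (K + 1) + 2 * (2 * K + 2)) := by
        rw [hA]
        ring
    _ ≤ d * n ^ (20 * (K + 1) * 1) := by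
        gcongr
        · omega
        · omega

/-! ### The two programs -/

section Main

variable {n d t : ℕ} {γ : ℝ} {X : Fin n → EuclideanSpace ℝ (Fin d)} {y : Fin n → Bool}

theorem exhaustiveSearch_computes (hn : 2 ≤ n) (hγ : 0 < γ) (hγ1 : γ ≤ 1) (hX : ∀ i, ‖X i‖ ≤ 1)
    {P : TPolytope d t} (hP : P.Consistent γ X y) (ε : ℝ≥0∞) :
    Computes exhaustiveSearch (input t γ X y)
      (d * (n : ℝ) ^ (200 * (t * (γ ^ 2)⁻¹ * Real.log (2 / γ)))) ε
      fun s => ∃ Q : TPolytope d t, Outputs s Q ∧ Q.Consistent (γ / 4) X y := by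
  have hn0 : 0 < n := by omega
  have ht := hP.pos hγ hn0
  have hd := P.dim_pos ht
  have hrun : Run exhaustiveSearch (input t γ X y) _ ((inst t γ X y hn0 hd).Solved t) :=
    (computeK_run hγ rfl rfl).seq fun s₁ f₁ h₁ => Run.straight_seq rfl <| by
      have hs₁ : Loaded (inst t γ X y hn0 hd) s₁ := loaded_inst f₁ (by decide) (by decide) h₁
      refine exhaustiveSearch_loop (inst_coverable hγ hγ1 hX hP)
        (hs₁.frame (Frame.effect rfl s₁) (by decide) (by decide)) ?_ ?_ ?_ rfl
      · simpa [Prog.effect] using hs₁.t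
      · simp [Prog.effect, f₁.nat 6 (by decide), input]
      · simp [Prog.effect, NatExpr.eval]
  refine (hrun.mono le_rfl fun s _ h => exists_output ht hγ h).computes
    (time_le hn (exhaustive_time (K := ⌈3 / γ ^ 2⌉₊) hn hd ht rfl) (exponent_le hγ hγ1) rfl) ε

theorem greedyCover_computes (hn : 2 ≤ n) (hγ : 0 < γ) (hγ1 : γ ≤ 1) (hX : ∀ i, ‖X i‖ ≤ 1)
    {P : TPolytope d t} (hP : P.Consistent γ X y) (ε : ℝ≥0∞) :
    Computes greedyCover (input t γ X y)
      (d * (n : ℝ) ^ (200 * ((γ ^ 2)⁻¹ * Real.log (2 / γ)))) ε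
      fun s => ∃ (r : ℕ) (Q : TPolytope d r), (r : ℝ) ≤ 200 * (t * Real.log n) ∧
        Outputs s Q ∧ Q.Consistent (γ / 4) X y := by
  have hn0 : 0 < n := by omega
  have ht := hP.pos hγ hn0
  have hd := P.dim_pos ht
  have hrun : Run greedyCover (input t γ X y)
      (23 * ⌈3 / γ ^ 2⌉₊ + 15 + (n * (40 + 16) + 12 + ((n + 1) *
        (6 + ((inst t γ X y hn0 hd).findTime + (n * (38 * d + 20 + 25 + 16) + 12 + 20)) + 13) +
          13)))
      fun s => ∃ r : ℕ, (r : ℝ) ≤ t * Real.log n + 1 ∧ 0 < r ∧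
        (inst t γ X y hn0 hd).Solved r s := by
    refine (computeK_run hγ rfl rfl).seq fun s₁ f₁ h₁ => ?_
    have hs₁ : Loaded (inst t γ X y hn0 hd) s₁ := loaded_inst f₁ (by decide) (by decide) h₁
    refine (initMarks_run hs₁ (by rw [f₁.nat 19 (by decide)]; rfl)).seq fun s₂ f₂ ⟨h₂, h₂'⟩ => ?_
    have hs₂ := hs₁.frame f₂ (by decide) (by decide)
    have h4 : s₂.nat 4 0 0 = 0 := by rw [f₂.nat 4 (by decide), f₁.nat 4 (by decide)]; rfl
    have hle : s₂.nat 19 0 0 ≤ n := by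
      rw [h₂']
      refine (Finset.sum_le_card_nsmul _ _ 1 fun i _ => Nat.sub_le _ _).trans ?_
      simp [inst]
    have hlog : 0 ≤ (t : ℝ) * Real.log n :=
      mul_nonneg t.cast_nonneg (Real.log_natCast_nonneg n)
    have hinv : GreedyInv (inst t γ X y hn0 hd) s₂ :=
      { loaded := hs₂
        unit := by simp [h4]
        pos := by simp [h4]
        mark_pos := fun i hi hy => by rw [h₂ i hi]; omega
        mark_neg := fun i hi hy hz => by rw [h₂ i hi, hy] at hz; omega
        count := by
          rw [h₂']
          exact Finset.sum_congr rfl fun i hi => (h₂ i (Finset.mem_range.1 hi)).symm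
        decay := by
          have : (s₂.nat 19 0 0 : ℝ) ≤ n := by exact_mod_cast hle
          simpa [h4, inst] using this
        rows := by
          rw [h4]
          simp only [inst, Nat.cast_zero]
          linarith }
    refine (greedyCover_loop (inst_coverable hγ hγ1 hX hP) ht hinv).time ?_
    simp only [inst]
    gcongr
  refine (hrun.mono le_rfl ?_).computes (time_le hn
    (greedy_time (K := ⌈3 / γ ^ 2⌉₊) hn hd rfl) (exponent_le (t := 1) hγ hγ1) (by simp)) ε
  rintro s - ⟨r, hr, hr0, hsol⟩
  obtain ⟨Q, hQ⟩ := exists_output hr0 hγ hsol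
  refine ⟨r, Q, hr.trans ?_, hQ⟩
  have h1 : 1 / 2 ≤ Real.log n := by
    have : Real.log 2 ≤ Real.log n := Real.log_le_log (by norm_num) (by exact_mod_cast hn)
    linarith [Real.log_two_gt_d9]
  have h2 : (1 : ℝ) ≤ t := by exact_mod_cast ht
  nlinarith

end Main

end RealRAM

theorem mainTheorem1 (c : ℕ) :
    (∃ C : ℝ, 0 < C ∧ ∃ prog : RealRAM.Prog,
      ∀ (n d t : ℕ) (γ : ℝ) (X : Fin n → EuclideanSpace ℝ (Fin d)) (y : Fin n → Bool),
        2 ≤ n → 0 < γ → γ ≤ 1 → (∀ i, ‖X i‖ ≤ 1) →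
        (∃ P : TPolytope d t, P.Consistent γ X y) →
        RealRAM.Computes prog (RealRAM.input t γ X y)
          ((d : ℝ) * (n : ℝ) ^ (C * (t * (γ ^ 2)⁻¹ * Real.log (2 / γ))))
          ((n : ℝ≥0∞) ^ c)⁻¹
          (fun s => ∃ Q : TPolytope d t, RealRAM.Outputs s Q ∧ Q.Consistent (γ / 4) X y)) ∧
    (∃ C : ℝ, 0 < C ∧ ∃ prog : RealRAM.Prog,
      ∀ (n d t : ℕ) (γ : ℝ) (X : Fin n → EuclideanSpace ℝ (Fin d)) (y : Fin n → Bool),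
        2 ≤ n → 0 < γ → γ ≤ 1 → (∀ i, ‖X i‖ ≤ 1) →
        (∃ P : TPolytope d t, P.Consistent γ X y) →
        RealRAM.Computes prog (RealRAM.input t γ X y)
          ((d : ℝ) * (n : ℝ) ^ (C * ((γ ^ 2)⁻¹ * Real.log (2 / γ))))
          ((n : ℝ≥0∞) ^ c)⁻¹
          (fun s => ∃ (r : ℕ) (Q : TPolytope d r), (r : ℝ) ≤ C * (t * Real.log n) ∧
            RealRAM.Outputs s Q ∧ Q.Consistent (γ / 4) X y)) :=
  ⟨⟨200, by norm_num, RealRAM.exhaustiveSearch, fun _ _ _ _ _ _ hn hγ hγ1 hX ⟨_, hP⟩ =>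
      RealRAM.exhaustiveSearch_computes hn hγ hγ1 hX hP _⟩,
    ⟨200, by norm_num, RealRAM.greedyCover, fun _ _ _ _ _ _ hn hγ hγ1 hX ⟨_, hP⟩ =>
      RealRAM.greedyCover_computes hn hγ hγ1 hX hP _⟩⟩
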